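/- Let $d\ge 5$ and let $T$ be the Cayley tree (Bethe lattice) of degree $d$, i.e. an infinite tree all of whose vertices have degree $d$, with a root $\bar 0$. Let $T_n$ be the set of vertices at distance at most $n$ from $\bar 0$, and let $\partial T_n$ be the set of vertices at distance exactly $n+1$. Each vertex carries a spin $d/2$, with state space $\mathbb C^{d+1}$ realized as the homogeneous polynomials of degree $d$ in $u_x,v_x$, with orthonormal basis $\sqrt{(d+1)\binom dj}\,u_x^jv_x^{d-j}$ ($0\le j\le d$). Put $\mathcal A_n=\bigotimes_{x\in T_n}M_{d+1}(\mathbb C)$, and let $\mathcal A$ be the quasi-local algebra, the norm completion of $\bigcup_n\mathcal A_n$ under the inclusions $A\mapsto A\otimes 1$. The AKLT Hamiltonian of $T_n$ is $H_n=\sum_{(x,y)}P_{xy}$, summed over the edges with both ends in $T_n$, where $P_{xy}$ is the orthogonal projection onto the states in which the spins at $x$ and $y$ have the maximal total spin $d$. Let $\psi_n:(\mathbb C^2)^{\otimes\partial T_n}\to(\mathbb C^{d+1})^{\otimes T_n}$ be the valence bond map: the matrix element of $\psi_n$ between a product basis vector of the spins in $T_n$ and a product basis vector of the spins $\tfrac12$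 in $\partial T_n$ is the coefficient (with respect to the above orthonormal basis at the vertices of $T_n$, and the basis $u_y,v_y$ at those of $\partial T_n$) of the polynomial $\prod_{(x,y)}(u_xv_y-v_xu_y)$, where the product is over all edges with $x\in T_n$, $y\in T_n\cup\partial T_n$, oriented away from the root. For a positive semidefinite boundary condition $B\in M_2(\mathbb C)^{\otimes\partial T_n}$ with $\operatorname{Tr}(\psi_nB\psi_n^*)\ne0$ let $$\omega^n_B(A)=\frac{\operatorname{Tr}(\psi_nB\psi_n^*A)}{\operatorname{Tr}(\psi_nB\psi_n^*)}\qquad(A\in\mathcal A_n).$$ An infinite-volume ground state is a functional $\omega:\mathcal A\to\mathbb C$ for which there are such boundary conditions $B_n$ on $T_n$, $n\ge0$, for which the finite-volume states are ground states ($H_n\psi_nB_n\psi_n^*=0$) and $\omega(A)=\lim_{n\to\infty}\omega^n_{B_n}(A_n)$ for every $A\in\mathcal A$ and all $A_n\in\mathcal A_n$ with $A_n\to A$ in norm. **Theorem.** For $d\ge5$ the AKLT infinite-volume ground state on the Cayley tree of degree $d$ is not unique: there are two different infinite-volume ground states $\omega_1\neq\omega_2$. -/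

import Mathlib

open scoped ComplexOrder

namespace AKLT

variable {V : Type*}

/-! ## Layers and volumes of a rooted, locally finite graph -/

theorem finite_ball (G : SimpleGraph V) [G.LocallyFinite] (o : V) (n : ℕ) :
    {x : V | G.edist o x ≤ n}.Finite := by
  have key : ∀ n : ℕ, {x : V | ∃ p : G.Walk x o, p.length ≤ n}.Finite := by
    intro n
    induction n with
    | zero =>
      refine (Set.finite_singleton o).subset ?_
      rintro x ⟨p, hp⟩
      exact SimpleGraph.Walk.eq_of_length_eq_zero (Nat.le_zero.mp hp)
    | succ n ih =>
      refine ((Set.finite_singleton o).union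
        (ih.biUnion (fun y _ => (G.neighborSet y).toFinite))).subset ?_
      rintro x ⟨p, hp⟩
      cases p with
      | nil => exact Or.inl rfl
      | cons h q =>
        refine Or.inr (Set.mem_biUnion (show _ from ⟨q, ?_⟩) h.symm)
        simpa using hp
  refine (key n).subset ?_
  intro x hx
  have hne : G.edist o x ≠ ⊤ := ne_top_of_le_ne_top (ENat.natCast_ne_top n) hx
  obtain ⟨p, hp⟩ := SimpleGraph.exists_walk_of_edist_ne_top hne
  refine ⟨p.reverse, ?_⟩
  have : ((p.length : ℕ) : ℕ∞) ≤ n := hp ▸ hx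
  simpa using this

/-- The vertices of the finite tree `T_n`: those at distance at most `n` from the root `o`. -/
noncomputable def ball (G : SimpleGraph V) [G.LocallyFinite] (o : V) (n : ℕ) : Finset V :=
  (finite_ball G o n).toFinset

/-- The `n`-th layer: the vertices at distance exactly `n` from the root `o`. -/
noncomputable def layer (G : SimpleGraph V) [G.LocallyFinite] (o : V) (n : ℕ) : Finset V :=
  ((finite_ball G o n).subset
    (fun _ hx => le_of_eq hx : {x : V | G.edist o x = n} ⊆ {x : V | G.edist o x ≤ n})).toFinset

theorem ball_mono (G : SimpleGraph V) [G.LocallyFinite] (o : V) {m n : ℕ} (h : m ≤ n) :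
    ball G o m ⊆ ball G o n := by
  intro x hx
  simp only [ball, Set.Finite.mem_toFinset, Set.mem_ofPred_eq] at hx ⊢
  exact hx.trans (by exact_mod_cast h)

/-- `(x, y)` is an edge of the tree, oriented away from the root `o`. -/
def IsEdge (G : SimpleGraph V) (o x y : V) : Prop :=
  G.Adj x y ∧ G.dist o y = G.dist o x + 1

/-! ## Spins

A site carries a spin `d/2`.  In the Weyl representation its state space consists of the
homogeneous polynomials of degree `d` in `u, v`, with the orthonormal basis
`√((d + 1) * d.choose j) * u ^ j * v ^ (d - j)`, `j = 0, …, d`, in which all operators and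
vectors below are written. -/

/-- The raising operator `S⁺ = u ∂/∂v`. -/
noncomputable def spinPlus (d : ℕ) : Matrix (Fin (d + 1)) (Fin (d + 1)) ℂ :=
  Matrix.of fun i j =>
    if (i : ℕ) = (j : ℕ) + 1 then ((Real.sqrt (((d : ℝ) - (j : ℕ)) * ((j : ℕ) + 1)) : ℝ) : ℂ) else 0

/-- The spin operators `S^x, S^y, S^z` of spin `d/2`, where `S^± = S^x ± i S^y` and
`S^z = (u ∂/∂u - v ∂/∂v) / 2`. -/
noncomputable def spin (d : ℕ) : Fin 3 → Matrix (Fin (d + 1)) (Fin (d + 1)) ℂ :=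
  ![(1 / 2 : ℂ) • (spinPlus d + (spinPlus d).conjTranspose),
    (1 / (2 * Complex.I) : ℂ) • (spinPlus d - (spinPlus d).conjTranspose),
    Matrix.diagonal fun j => ((j : ℕ) : ℂ) - (d : ℂ) / 2]

section Volume

variable [DecidableEq V] (G : SimpleGraph V) [G.LocallyFinite] (o : V) (d n : ℕ)

/-- Labels of the product orthonormal basis of `⨂_{x ∈ T_n} ℂ^{d+1}`. -/
abbrev Config : Type _ := ↥(ball G o n) → Fin (d + 1)

/-- Labels of the product basis of `⨂_{y ∈ ∂T_n} ℂ²`, where `∂T_n` is layer `n + 1`;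
the value `1` stands for spin up and `0` for spin down. -/
abbrev BdryConfig : Type _ := ↥(layer G o (n + 1)) → Fin 2

/-- The algebra of observables of the volume `T_n`. -/
abbrev Obs : Type _ := Matrix (Config G o d n) (Config G o d n) ℂ

variable {d n}

/-- The operator acting as `M` at the site `x` and as the identity at all other sites. -/
noncomputable def siteOp (x : ↥(ball G o n)) (M : Matrix (Fin (d + 1)) (Fin (d + 1)) ℂ) :
    Obs G o d n :=
  open Classical in
  Matrix.of fun s t => if ∀ z, z ≠ x → s z = t z then M (s x) (t x) else 0

/-- The square of the total spin of the two sites `x` and `y`. -/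
noncomputable def totalSpinSq (x y : ↥(ball G o n)) : Obs G o d n :=
  ∑ a : Fin 3, (siteOp G o x (spin d a) + siteOp G o y (spin d a)) ^ 2

/-- The subspace on which the sites `x` and `y` have the maximal total spin `d = d/2 + d/2`:
the eigenspace of the squared total spin for the eigenvalue `d (d + 1)`. -/
noncomputable def maxSpinSpace (x y : ↥(ball G o n)) :
    Submodule ℂ (EuclideanSpace ℂ (Config G o d n)) :=
  Module.End.eigenspace (Matrix.toEuclideanLin (totalSpinSq (d := d) G o x y))
    ((d : ℂ) * ((d : ℂ) + 1))

variable (d n)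

/-- The AKLT Hamiltonian of the volume `T_n`: the sum over the edges of `T_n` of the orthogonal
projections onto maximal total spin. -/
noncomputable def hamiltonian :
    EuclideanSpace ℂ (Config G o d n) →L[ℂ] EuclideanSpace ℂ (Config G o d n) :=
  open Classical in
  ∑ x : ↥(ball G o n), ∑ y : ↥(ball G o n),
    if IsEdge G o x y then (maxSpinSpace (d := d) G o x y).starProjection else 0

/-- The product of the singlets `u_x v_y - v_x u_y` over all edges `(x, y)` of `T_n`, including
those which join the last layer of `T_n` to the boundary `∂T_n`.  The variables are
`u_x = X (x, 0)` and `v_x = X (x, 1)`. -/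
noncomputable def vbsPoly : MvPolynomial (V × Fin 2) ℂ :=
  open Classical in
  ∏ x ∈ ball G o n, ∏ y ∈ ball G o (n + 1),
    if IsEdge G o x y then
      MvPolynomial.X (x, 0) * MvPolynomial.X (y, 1) - MvPolynomial.X (x, 1) * MvPolynomial.X (y, 0)
    else 1

variable {d n}

/-- The exponents of `∏_{x ∈ T_n} u_x ^ s_x v_x ^ (d - s_x) ∏_{y ∈ ∂T_n} u_y ^ τ_y v_y ^ (1 - τ_y)`.
-/
noncomputable def exponents (s : Config G o d n) (τ : BdryConfig G o n) : V × Fin 2 →₀ ℕ :=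
  (∑ x : ↥(ball G o n), (Finsupp.single ((x : V), 0) (s x : ℕ)
      + Finsupp.single ((x : V), 1) (d - (s x : ℕ))))
    + ∑ y : ↥(layer G o (n + 1)), (Finsupp.single ((y : V), 0) (τ y : ℕ)
      + Finsupp.single ((y : V), 1) (1 - (τ y : ℕ)))

variable (d n)

/-- The linear map `ψ_n : ⨂_{y ∈ ∂T_n} ℂ² → ⨂_{x ∈ T_n} ℂ^{d+1}` which sends a vector of the
boundary spins to the AKLT (valence bond) vector of `T_n` with that boundary condition, written in
the orthonormal bases. -/
noncomputable def vbs : Matrix (Config G o d n) (BdryConfig G o n) ℂ :=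
  Matrix.of fun s τ => (vbsPoly G o n).coeff (exponents G o s τ) *
    ∏ x : ↥(ball G o n), ((Real.sqrt (((d : ℝ) + 1) * (d.choose (s x : ℕ) : ℝ)) : ℝ) : ℂ)⁻¹

variable {d n}

/-- The density matrix `ψ_n B ψ_n* / Tr (ψ_n B ψ_n*)` of the finite-volume state on `T_n` with
boundary condition `B`, a matrix in `M_2^{⊗ ∂T_n}`. -/
noncomputable def density (B : Matrix (BdryConfig G o n) (BdryConfig G o n) ℂ) : Obs G o d n :=
  ((vbs G o d n * B * (vbs G o d n).conjTranspose).trace)⁻¹ •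
    (vbs G o d n * B * (vbs G o d n).conjTranspose)

/-- `ρ` is the density matrix of a ground state of the AKLT Hamiltonian of `T_n`: it is positive
of trace one, and has energy zero for the (nonnegative) Hamiltonian. -/
def IsFiniteVolumeGroundState (ρ : Obs G o d n) : Prop :=
  ρ.PosSemidef ∧ ρ.trace = 1 ∧
    ∀ φ : EuclideanSpace ℂ (Config G o d n), hamiltonian G o d n (Matrix.toEuclideanLin ρ φ) = 0

/-! ## Infinite volume -/

/-- The inclusion `A ↦ A ⊗ 1` of the observables of `T_m` into those of `T_n`, `m ≤ n`. -/
noncomputable def embed {m n : ℕ} (h : m ≤ n) (A : Obs G o d m) : Obs G o d n :=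
  open Classical in
  Matrix.of fun s t =>
    if ∀ z : ↥(ball G o n), (z : V) ∉ ball G o m → s z = t z then
      A (fun x => s ⟨x, ball_mono G o h x.2⟩) (fun x => t ⟨x, ball_mono G o h x.2⟩)
    else 0

variable (d)

/-- A quasi-local observable, i.e. an element of the completion of `⋃_n Obs n` in the operator
norm, given by a Cauchy sequence of local observables `obs n` of `T_n`.  (Sequences with
`‖obs n - obs' n‖ → 0` represent the same element, and get the same value in each limit of
states.) A local observable `A` of `T_m` is represented by `A ⊗ 1`, for `n ≥ m`. -/
structure QuasiLocalObs where
  obs : ∀ n : ℕ, Obs G o d n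
  cauchy : ∀ ε : ℝ, 0 < ε → ∃ N : ℕ, ∀ (n : ℕ) (h : N ≤ n),
    ‖Matrix.toEuclideanCLM (𝕜 := ℂ) (obs n - embed G o h (obs N))‖ ≤ ε

variable {d}

/-- `ω` is an infinite-volume ground state: there is a sequence of boundary conditions `B n` on
`T_n` such that the states on `T_n` with these boundary conditions are ground states of the
finite-volume Hamiltonians and converge weakly to `ω`. -/
def IsInfiniteVolumeGroundState (ω : QuasiLocalObs G o d → ℂ) : Prop :=
  ∃ B : ∀ n : ℕ, Matrix (BdryConfig G o n) (BdryConfig G o n) ℂ,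
    (∀ n, (B n).PosSemidef ∧ IsFiniteVolumeGroundState G o (density (d := d) G o (B n))) ∧
    ∀ A : QuasiLocalObs G o d,
      Filter.Tendsto (fun n => (density (d := d) G o (B n) * A.obs n).trace) Filter.atTop
        (nhds (ω A))

end Volume

end AKLT

/-!
The energy is zero for every boundary condition: a state in which the spins at the ends of an edge
`(x, y)` have maximal total spin is invariant under hopping of units of spin between `x` and `y`,
so it is orthogonal to all multiples of the antisymmetric singlet `u_x v_y - v_x u_y`.

When the outermost layer of `T_{n+1}` is traced out, a boundary condition on `T_{n+1}` becomes one
on `T_n`. Products of diagonal weights `b` at the boundary vertices are mapped to products of this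
form, by a map of one-vertex weights. For `d ≥ 5` this map has, up to a factor, a two-periodic orbit
which exchanges the weights `(r, 1)` and `(1, r)` for some `r < 1`. Alternating between them gives
two consistent sequences of finite-volume states, which correspond to the two choices of the
sublattice with predominantly upward spins and differ already at the root.
-/

namespace AKLT

section Layers

variable {V : Type*} {G : SimpleGraph V} [G.LocallyFinite] {o x : V} {n : ℕ}

theorem mem_ball_iff_edist_le : x ∈ ball G o n ↔ G.edist o x ≤ n := by
  simp [ball]

theorem mem_layer_iff_edist_eq : x ∈ layer G o n ↔ G.edist o x = n := by
  simp [layer]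

theorem mem_ball_zero : x ∈ ball G o 0 ↔ x = o := by
  rw [mem_ball_iff_edist_le, Nat.cast_zero, nonpos_iff_eq_zero, SimpleGraph.edist_eq_zero_iff,
    eq_comm]

theorem mem_layer_zero : x ∈ layer G o 0 ↔ x = o := by
  rw [mem_layer_iff_edist_eq, Nat.cast_zero, SimpleGraph.edist_eq_zero_iff, eq_comm]

theorem ball_zero_eq_layer_zero : ball G o 0 = layer G o 0 :=
  Finset.ext fun _ => mem_ball_zero.trans mem_layer_zero.symm

theorem card_layer_one : (layer G o 1).card = G.degree o := by
  rw [← SimpleGraph.card_neighborFinset_eq_degree]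
  congr 1
  ext x
  rw [mem_layer_iff_edist_eq, Nat.cast_one, SimpleGraph.edist_eq_one_iff_adj,
    SimpleGraph.mem_neighborFinset]

theorem mem_ball_succ : x ∈ ball G o (n + 1) ↔ x ∈ ball G o n ∨ x ∈ layer G o (n + 1) := by
  rw [mem_ball_iff_edist_le, mem_ball_iff_edist_le, mem_layer_iff_edist_eq, le_iff_lt_or_eq,
    Nat.cast_succ, ENat.lt_add_one_iff (ENat.natCast_ne_top n)]

theorem ball_succ [DecidableEq V] : ball G o (n + 1) = ball G o n ∪ layer G o (n + 1) :=
  Finset.ext fun _ => by rw [Finset.mem_union, mem_ball_succ]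

theorem disjoint_ball_layer : Disjoint (ball G o n) (layer G o (n + 1)) := by
  rw [Finset.disjoint_left]
  intro x hball hlayer
  rw [mem_ball_iff_edist_le] at hball
  rw [mem_layer_iff_edist_eq] at hlayer
  rw [hlayer, Nat.cast_le] at hball
  omega

theorem coe_ball_ne_coe_layer (x : ball G o n) (y : layer G o (n + 1)) : (x : V) ≠ y :=
  fun h => Finset.disjoint_left.1 disjoint_ball_layer x.2 (h ▸ y.2)

theorem mem_layer_iff (hG : G.Connected) : x ∈ layer G o n ↔ G.dist o x = n := by
  rw [mem_layer_iff_edist_eq, ← (hG.preconnected o x).coe_dist_eq_edist, Nat.cast_inj]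

end Layers

section Parent

variable {V : Type*} {G : SimpleGraph V} {o : V} {n : ℕ}

theorem exists_isEdge_of_dist_eq_succ (hG : G.Connected) {y : V} (hy : G.dist o y = n + 1) :
    ∃ x, IsEdge G o x y := by
  obtain ⟨p, hp⟩ := hG.exists_walk_length_eq_dist y o
  cases p with
  | nil => simp at hy
  | @cons _ x _ h q =>
    refine ⟨x, h.symm, ?_⟩
    rw [SimpleGraph.Walk.length_cons, SimpleGraph.dist_comm, hy] at hp
    have hxo : G.dist o x ≤ n := by
      rw [SimpleGraph.dist_comm]
      exact (SimpleGraph.dist_le q).trans (by omega)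
    have hoy : G.dist o y ≤ G.dist o x + G.dist x y := hG.dist_triangle
    rw [SimpleGraph.dist_eq_one_iff_adj.2 h.symm] at hoy
    omega

theorem IsEdge.left_unique (hG : G.IsTree) {x x' y : V} (h : IsEdge G o x y)
    (h' : IsEdge G o x' y) : x = x' := by
  have exists_isPath : ∀ x, IsEdge G o x y → ∃ p : G.Walk y o, p.IsPath ∧ p.snd = x := by
    rintro x ⟨hadj, hdist⟩
    obtain ⟨p, hp⟩ := hG.1.exists_walk_length_eq_dist x o
    refine ⟨.cons hadj.symm p, SimpleGraph.Walk.isPath_of_length_eq_dist _ ?_, by simp⟩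
    rw [SimpleGraph.Walk.length_cons, hp, SimpleGraph.dist_comm, SimpleGraph.dist_comm (u := y),
      hdist]
  obtain ⟨p, hp, rfl⟩ := exists_isPath x h
  obtain ⟨q, hq, rfl⟩ := exists_isPath x' h'
  rw [(hG.existsUnique_path y o).unique hp hq]

variable [G.LocallyFinite]

theorem IsEdge.mem_layer_iff_mem_layer_succ (hG : G.Connected) {x y : V} (h : IsEdge G o x y) :
    x ∈ layer G o n ↔ y ∈ layer G o (n + 1) := by
  rw [mem_layer_iff hG, mem_layer_iff hG, h.2, Nat.add_right_cancel_iff]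

theorem exists_isEdge_of_mem_layer_succ (hG : G.Connected) (y : layer G o (n + 1)) :
    ∃ x : layer G o n, IsEdge G o x y := by
  obtain ⟨x, hx⟩ := exists_isEdge_of_dist_eq_succ hG ((mem_layer_iff hG).1 y.2)
  exact ⟨⟨x, (hx.mem_layer_iff_mem_layer_succ hG).2 y.2⟩, hx⟩

/-- The neighbour in layer `n` of a vertex of layer `n + 1`. -/
noncomputable def parent (hG : G.Connected) (n : ℕ) (y : layer G o (n + 1)) : layer G o n :=
  (exists_isEdge_of_mem_layer_succ hG y).choose

theorem isEdge_parent (hG : G.Connected) (y : layer G o (n + 1)) :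
    IsEdge G o (parent hG n y) y :=
  (exists_isEdge_of_mem_layer_succ hG y).choose_spec

theorem isEdge_iff_eq_parent (hG : G.IsTree) {x : V} (y : layer G o (n + 1)) :
    IsEdge G o x y ↔ x = parent hG.1 n y :=
  ⟨fun h => h.left_unique hG (isEdge_parent hG.1 y), fun h => h ▸ isEdge_parent hG.1 y⟩

/-- The children of a vertex of layer `n` are the endpoints of the edges leaving it. -/
noncomputable def parentFiberEquiv (hG : G.IsTree) (x : layer G o n) :
    {y // parent hG.1 n y = x} ≃ {y // IsEdge G o x y} where
  toFun y := ⟨y, (isEdge_iff_eq_parent hG _).2 (congrArg _ y.2).symm⟩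
  invFun y := ⟨⟨y, (y.2.mem_layer_iff_mem_layer_succ hG.1).1 x.2⟩,
    Subtype.ext ((isEdge_iff_eq_parent hG ⟨y, _⟩).1 y.2).symm⟩
  left_inv _ := rfl
  right_inv _ := rfl

theorem isEdge_iff_mem_erase_neighborFinset [DecidableEq V] (hG : G.IsTree)
    (x : layer G o (n + 1)) {y : V} :
    IsEdge G o x y ↔ y ∈ (G.neighborFinset x).erase (parent hG.1 n x) := by
  rw [Finset.mem_erase, SimpleGraph.mem_neighborFinset, IsEdge, and_comm (a := y ≠ _),
    and_congr_right_iff]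
  intro h
  have dist_parent := (isEdge_parent hG.1 x).2
  rcases hG.dist_eq_dist_add_one_of_adj o h with hx | hy
  · have : y = parent hG.1 n x := (isEdge_iff_eq_parent hG x).1 ⟨h.symm, hx⟩
    simp only [this, ne_eq, not_true_eq_false, iff_false]
    omega
  · refine iff_of_true hy fun he => ?_
    rw [he] at hy
    omega

theorem card_parent_fiber_add_one [DecidableEq V] (hG : G.IsTree) (x : layer G o (n + 1)) :
    Fintype.card {y // parent hG.1 (n + 1) y = x} + 1 = G.degree x := by
  rw [← SimpleGraph.card_neighborFinset_eq_degree,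
    ← Finset.card_erase_add_one
      ((G.mem_neighborFinset _ _).2 (isEdge_parent hG.1 x).1.symm), ← Fintype.card_coe,
    Fintype.card_congr ((parentFiberEquiv hG x).trans
      (Equiv.subtypeEquivRight fun _ => isEdge_iff_mem_erase_neighborFinset hG x))]

end Parent

section SiteExponents

variable {V : Type*}

/-- The exponents of `u_x ^ j * v_x ^ (m - j)`. -/
noncomputable def siteExponents (m : ℕ) (x : V) (j : ℕ) : V × Fin 2 →₀ ℕ :=
  Finsupp.single (x, 0) j + Finsupp.single (x, 1) (m - j)

theorem siteExponents_apply_zero (m : ℕ) (x : V) (j : ℕ) : siteExponents m x j (x, 0) = j := by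
  simp [siteExponents]

theorem siteExponents_apply_one (m : ℕ) (x : V) (j : ℕ) :
    siteExponents m x j (x, 1) = m - j := by
  simp [siteExponents]

theorem siteExponents_apply_of_ne {x z : V} (h : x ≠ z) (m j : ℕ) (i : Fin 2) :
    siteExponents m x j (z, i) = 0 := by
  simp [siteExponents, h]

theorem siteExponents_add {a b j k : ℕ} (hj : j ≤ a) (hk : k ≤ b) (x : V) :
    siteExponents (a + b) x (j + k) = siteExponents a x j + siteExponents b x k := by
  have hsub : a + b - (j + k) = (a - j) + (b - k) := by omega
  simp only [siteExponents, hsub, Finsupp.single_add]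
  abel

theorem single_one_sub_eq_siteExponents (y : V) (i : Fin 2) :
    Finsupp.single (y, 1 - i) 1 = siteExponents 1 y i := by
  obtain rfl | rfl : i = 0 ∨ i = 1 := by omega
  all_goals simp [siteExponents]

/-- The number of sites at which the configuration `τ` of spins `1/2` points down. -/
def downCount {κ : Type*} [Fintype κ] (τ : κ → Fin 2) : ℕ :=
  (Finset.univ.filter fun y => τ y = 0).card

theorem downCount_le_card {κ : Type*} [Fintype κ] (τ : κ → Fin 2) :
    downCount τ ≤ Fintype.card κ :=
  Finset.card_le_univ _

theorem sum_single_eq_siteExponents {κ : Type*} [Fintype κ] (x : V) (τ : κ → Fin 2) :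
    ∑ y, Finsupp.single (x, τ y) 1 = siteExponents (Fintype.card κ) x (downCount τ) := by
  have single_eq : ∀ i : Fin 2, Finsupp.single (x, i) 1 =
      (if i = 0 then Finsupp.single (x, 0) 1 else 0) +
        if ¬ i = 0 then Finsupp.single (x, 1) 1 else (0 : V × Fin 2 →₀ ℕ) := fun i => by
    obtain rfl | rfl : i = 0 ∨ i = 1 := by omega
    all_goals simp
  have card_not : (Finset.univ.filter fun y => ¬ τ y = 0).card =
      Fintype.card κ - downCount τ := by
    rw [downCount, ← Finset.card_univ,
      ← Finset.card_filter_add_card_filter_not (s := Finset.univ) (fun y => τ y = 0),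
      add_tsub_cancel_left]
  rw [Finset.sum_congr rfl fun y _ => single_eq (τ y), Finset.sum_add_distrib,
    ← Finset.sum_filter, ← Finset.sum_filter, Finset.sum_const, Finset.sum_const, card_not,
    Finsupp.smul_single_one, Finsupp.smul_single_one]
  rfl

end SiteExponents

section EdgeExponents

variable {V : Type*} {G : SimpleGraph V} [G.LocallyFinite] {o : V} {d n : ℕ}

theorem exponents_eq_sum_siteExponents (s : Config G o d n) (τ : BdryConfig G o n) :
    exponents G o s τ = ∑ x : ball G o n, siteExponents d (x : V) (s x) +
      ∑ y : layer G o (n + 1), siteExponents 1 (y : V) (τ y) :=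
  rfl

theorem exponents_apply_ball (s : Config G o d n) (τ : BdryConfig G o n) (x : ball G o n)
    (i : Fin 2) : exponents G o s τ (x, i) = siteExponents d (x : V) (s x) (x, i) := by
  rw [exponents_eq_sum_siteExponents, Finsupp.add_apply, Finsupp.finsetSum_apply,
    Finsupp.finsetSum_apply, Finset.sum_eq_single x, Finset.sum_eq_zero, add_zero]
  · exact fun y _ => siteExponents_apply_of_ne (coe_ball_ne_coe_layer x y).symm ..
  · exact fun z _ hz => siteExponents_apply_of_ne (Subtype.coe_ne_coe.2 hz) ..
  · simp

theorem exponents_apply_layer (s : Config G o d n) (τ : BdryConfig G o n)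
    (y : layer G o (n + 1)) (i : Fin 2) :
    exponents G o s τ (y, i) = siteExponents 1 (y : V) (τ y) (y, i) := by
  rw [exponents_eq_sum_siteExponents, Finsupp.add_apply, Finsupp.finsetSum_apply,
    Finsupp.finsetSum_apply, Finset.sum_eq_zero, zero_add, Finset.sum_eq_single y]
  · exact fun z _ hz => siteExponents_apply_of_ne (Subtype.coe_ne_coe.2 hz) ..
  · simp
  · exact fun x _ => siteExponents_apply_of_ne (coe_ball_ne_coe_layer x y) ..

/-- The exponents of the term of `∏ (u_x v_y - v_x u_y)`, over the edges between the layers `n` and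
`n + 1`, in which the variables of layer `n + 1` occur according to `τ`. -/
noncomputable def edgeExponents (hG : G.Connected) (τ : BdryConfig G o n) : V × Fin 2 →₀ ℕ :=
  ∑ y, (Finsupp.single ((parent hG n y : V), τ y) 1 + Finsupp.single ((y : V), 1 - τ y) 1)

theorem siteExponents_boundary_le_edgeExponents (hG : G.Connected) (τ : BdryConfig G o n)
    (y : layer G o (n + 1)) : siteExponents 1 (y : V) (τ y) ≤ edgeExponents hG τ := by
  rw [edgeExponents, ← single_one_sub_eq_siteExponents]
  exact le_add_self.trans (Finset.single_le_sum (f := fun y : layer G o (n + 1) =>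
    Finsupp.single ((parent hG n y : V), τ y) 1 + Finsupp.single ((y : V), 1 - τ y) 1)
    (fun _ _ => zero_le) (Finset.mem_univ y))

theorem eq_of_edgeExponents_le_exponents (hG : G.Connected) {s : Config G o d n}
    {τ τ' : BdryConfig G o n} (h : edgeExponents hG τ' ≤ exponents G o s τ) : τ' = τ := by
  funext y
  have hle := (siteExponents_boundary_le_edgeExponents hG τ' y).trans h
  have hzero := hle (y, 0)
  have hone := hle (y, 1)
  rw [exponents_apply_layer, siteExponents_apply_zero, siteExponents_apply_zero] at hzero
  rw [exponents_apply_layer, siteExponents_apply_one, siteExponents_apply_one] at hone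
  omega

variable [DecidableEq V]

/-- The number of children of `x` at which the boundary configuration `τ` points down. -/
noncomputable def childDownCount (hG : G.Connected) (τ : BdryConfig G o n)
    (x : layer G o n) : ℕ :=
  downCount fun y : {y // parent hG n y = x} => τ y

theorem edgeExponents_eq_sum_siteExponents (hG : G.Connected) (τ : BdryConfig G o n) :
    edgeExponents hG τ =
      ∑ x : layer G o n, siteExponents (Fintype.card {y // parent hG n y = x}) (x : V)
        (childDownCount hG τ x) + ∑ y : layer G o (n + 1), siteExponents 1 (y : V) (τ y) := by
  rw [edgeExponents, Finset.sum_add_distrib, ← Fintype.sum_fiberwise (parent hG n)]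
  congr 1
  · refine Finset.sum_congr rfl fun x _ => ?_
    rw [childDownCount, ← sum_single_eq_siteExponents]
    exact Finset.sum_congr rfl fun y _ => by rw [y.2]
  · exact Finset.sum_congr rfl fun y _ => single_one_sub_eq_siteExponents _ _

theorem siteExponents_parent_le_edgeExponents (hG : G.Connected) (τ : BdryConfig G o n)
    (x : layer G o n) :
    siteExponents (Fintype.card {y // parent hG n y = x}) (x : V) (childDownCount hG τ x) ≤
      edgeExponents hG τ := by
  rw [edgeExponents_eq_sum_siteExponents]
  exact (Finset.single_le_sum (f := fun x : layer G o n => siteExponents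
    (Fintype.card {y // parent hG n y = x}) (x : V) (childDownCount hG τ x))
    (fun _ _ => zero_le) (Finset.mem_univ x)).trans le_self_add

end EdgeExponents

section BallSucc

variable {V : Type*} [DecidableEq V] {G : SimpleGraph V} [G.LocallyFinite] {o : V} {d n : ℕ}

/-- The decomposition of `T_{n+1}` into `T_n` and layer `n + 1`. -/
noncomputable def ballSuccEquiv (G : SimpleGraph V) [G.LocallyFinite] (o : V) (n : ℕ) :
    ball G o n ⊕ layer G o (n + 1) ≃ ball G o (n + 1) :=
  (Equiv.Finset.union _ _ disjoint_ball_layer).trans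
    (Equiv.subtypeEquivRight fun _ => by rw [ball_succ])

@[simp]
theorem coe_ballSuccEquiv_inl (x : ball G o n) : (ballSuccEquiv G o n (.inl x) : V) = x := rfl

@[simp]
theorem coe_ballSuccEquiv_inr (x : layer G o (n + 1)) :
    (ballSuccEquiv G o n (.inr x) : V) = x := rfl

/-- Configurations of `T_{n+1}` as pairs of configurations of `T_n` and of layer `n + 1`. -/
noncomputable def configSuccEquiv (G : SimpleGraph V) [G.LocallyFinite] (o : V) (d n : ℕ) :
    Config G o d n × (layer G o (n + 1) → Fin (d + 1)) ≃ Config G o d (n + 1) :=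
  (Equiv.sumArrowEquivProdArrow _ _ _).symm.trans
    (Equiv.arrowCongr (ballSuccEquiv G o n) (Equiv.refl _))

@[simp]
theorem configSuccEquiv_inl (s : Config G o d n) (r : layer G o (n + 1) → Fin (d + 1))
    (x : ball G o n) : configSuccEquiv G o d n (s, r) (ballSuccEquiv G o n (.inl x)) = s x := by
  simp [configSuccEquiv, Equiv.arrowCongr]

@[simp]
theorem configSuccEquiv_inr (s : Config G o d n) (r : layer G o (n + 1) → Fin (d + 1))
    (x : layer G o (n + 1)) :
    configSuccEquiv G o d n (s, r) (ballSuccEquiv G o n (.inr x)) = r x := by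
  simp [configSuccEquiv, Equiv.arrowCongr]

theorem exponents_configSuccEquiv (s : Config G o d n) (r : layer G o (n + 1) → Fin (d + 1))
    (τ : BdryConfig G o (n + 1)) :
    exponents G o (configSuccEquiv G o d n (s, r)) τ =
      ∑ x : ball G o n, siteExponents d (x : V) (s x) +
        ∑ x : layer G o (n + 1), siteExponents d (x : V) (r x) +
          ∑ y : layer G o (n + 1 + 1), siteExponents 1 (y : V) (τ y) := by
  rw [exponents_eq_sum_siteExponents, ← (ballSuccEquiv G o n).sum_comp, Fintype.sum_sum_type]
  simp only [coe_ballSuccEquiv_inl, coe_ballSuccEquiv_inr, configSuccEquiv_inl,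
    configSuccEquiv_inr]

theorem exponents_configSuccEquiv_eq_add (hG : G.IsTree) (hdeg : G.IsRegularOfDegree d)
    {s : Config G o d n} {r : layer G o (n + 1) → Fin (d + 1)} {τ : BdryConfig G o (n + 1)}
    {σ : BdryConfig G o n} (hr : ∀ x, (r x : ℕ) = childDownCount hG.1 τ x + σ x) :
    exponents G o (configSuccEquiv G o d n (s, r)) τ =
      exponents G o s σ + edgeExponents hG.1 τ := by
  have siteExponents_eq : ∀ x : layer G o (n + 1), siteExponents d (x : V) (r x) =
      siteExponents (Fintype.card {y // parent hG.1 (n + 1) y = x}) (x : V)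
        (childDownCount hG.1 τ x) + siteExponents 1 (x : V) (σ x) := fun x => by
    rw [childDownCount, ← siteExponents_add (downCount_le_card _) (by omega),
      card_parent_fiber_add_one hG x, hdeg x, hr x, childDownCount]
  rw [exponents_configSuccEquiv, exponents_eq_sum_siteExponents,
    edgeExponents_eq_sum_siteExponents, Finset.sum_congr rfl fun x _ => siteExponents_eq x,
    Finset.sum_add_distrib]
  abel

theorem exists_eq_childDownCount_add (hG : G.IsTree) (hdeg : G.IsRegularOfDegree d)
    {s : Config G o d n} {r : layer G o (n + 1) → Fin (d + 1)} {τ : BdryConfig G o (n + 1)}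
    (h : edgeExponents hG.1 τ ≤ exponents G o (configSuccEquiv G o d n (s, r)) τ) :
    ∃ σ : BdryConfig G o n, ∀ x, (r x : ℕ) = childDownCount hG.1 τ x + σ x := by
  suffices ∀ x, ∃ i : Fin 2, (r x : ℕ) = childDownCount hG.1 τ x + i from
    ⟨fun x => (this x).choose, fun x => (this x).choose_spec⟩
  intro x
  have hcard := card_parent_fiber_add_one hG x
  rw [hdeg x] at hcard
  have hle := (siteExponents_parent_le_edgeExponents hG.1 τ x).trans h
  have hdown := hle (x, 0)
  have hup := hle (x, 1)
  rw [← coe_ballSuccEquiv_inr x, exponents_apply_ball, configSuccEquiv_inr,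
    siteExponents_apply_zero, siteExponents_apply_zero] at hdown
  rw [← coe_ballSuccEquiv_inr x, exponents_apply_ball, configSuccEquiv_inr,
    siteExponents_apply_one, siteExponents_apply_one] at hup
  have := (r x).isLt
  exact ⟨⟨r x - childDownCount hG.1 τ x, by omega⟩, (Nat.add_sub_of_le hdown).symm⟩

end BallSucc

section SingletProduct

open MvPolynomial

/-- The sign with which a configuration of spins `1/2` occurs in a product of singlets. -/
noncomputable def singletSign {κ : Type*} [Fintype κ] (τ : κ → Fin 2) : ℂ :=
  ∏ y, (-1) ^ (τ y : ℕ)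

theorem prod_singlet_eq_sum_monomial {V κ : Type*} [Fintype κ] [DecidableEq κ] (p c : κ → V) :
    (∏ y, (X (p y, 0) * X (c y, 1) - X (p y, 1) * X (c y, 0)) : MvPolynomial (V × Fin 2) ℂ) =
      ∑ τ : κ → Fin 2, monomial (∑ y, (Finsupp.single (p y, τ y) 1
        + Finsupp.single (c y, 1 - τ y) 1)) (singletSign τ) := by
  have singlet_eq : ∀ y,
      (X (p y, 0) * X (c y, 1) - X (p y, 1) * X (c y, 0) : MvPolynomial (V × Fin 2) ℂ) =
        ∑ i : Fin 2, monomial (Finsupp.single (p y, i) 1 + Finsupp.single (c y, 1 - i) 1)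
          ((-1 : ℂ) ^ (i : ℕ)) := fun y => by
    simp [Fin.sum_univ_two, X, monomial_mul, sub_eq_add_neg]
  simp_rw [singlet_eq]
  rw [Finset.prod_univ_sum, Fintype.piFinset_univ]
  exact Finset.sum_congr rfl fun τ _ => (monomial_sum_prod _ _ _).symm

variable {V : Type*} {G : SimpleGraph V} [G.LocallyFinite] {o : V} {n : ℕ}

/-- The product of the singlets over the edges between the layers `n` and `n + 1`. -/
noncomputable def layerPoly (hG : G.Connected) (o : V) (n : ℕ) : MvPolynomial (V × Fin 2) ℂ :=
  ∏ y : layer G o (n + 1), (X ((parent hG n y : V), 0) * X ((y : V), 1)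
    - X ((parent hG n y : V), 1) * X ((y : V), 0))

open Classical in
theorem layerPoly_eq_sum_monomial (hG : G.Connected) (o : V) (n : ℕ) :
    layerPoly hG o n =
      ∑ τ : BdryConfig G o n, monomial (edgeExponents hG τ) (singletSign τ) :=
  prod_singlet_eq_sum_monomial _ _

open Classical in
theorem prod_ite_isEdge_eq_prod_parent {M : Type*} [CommMonoid M] (hG : G.IsTree) (f : V → V → M) :
    (∏ x ∈ layer G o n, ∏ y ∈ ball G o (n + 1), if IsEdge G o x y then f x y else 1) =
      ∏ y : layer G o (n + 1), f (parent hG.1 n y) y := by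
  rw [Finset.prod_comm, ← Finset.prod_subset (fun y hy => mem_ball_succ.2 (.inr hy)),
    ← Finset.prod_coe_sort]
  · refine Finset.prod_congr rfl fun y _ => ?_
    rw [Finset.prod_eq_single (parent hG.1 n y : V), if_pos (isEdge_parent hG.1 y)]
    · exact fun x _ hx => if_neg fun h => hx ((isEdge_iff_eq_parent hG y).1 h)
    · exact fun h => absurd (parent hG.1 n y).2 h
  · exact fun y _ hy => Finset.prod_eq_one fun x hx =>
      if_neg fun h => hy ((h.mem_layer_iff_mem_layer_succ hG.1).1 hx)

theorem vbsPoly_zero (hG : G.IsTree) : vbsPoly G o 0 = layerPoly hG.1 o 0 := by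
  rw [vbsPoly, ball_zero_eq_layer_zero, prod_ite_isEdge_eq_prod_parent hG, layerPoly]

theorem vbsPoly_succ (hG : G.IsTree) :
    vbsPoly G o (n + 1) = vbsPoly G o n * layerPoly hG.1 o (n + 1) := by
  classical
  rw [vbsPoly, vbsPoly, ball_succ (n := n), Finset.prod_union disjoint_ball_layer,
    prod_ite_isEdge_eq_prod_parent hG, layerPoly, ← ball_succ]
  congr 1
  refine Finset.prod_congr rfl fun x hx => ?_
  rw [ball_succ (n := n + 1), Finset.prod_union disjoint_ball_layer,
    Finset.prod_eq_one (s := layer G o _), mul_one]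
  refine fun y hy => if_neg fun h => ?_
  exact Finset.disjoint_left.1 disjoint_ball_layer hx ((h.mem_layer_iff_mem_layer_succ hG.1).2 hy)

theorem coeff_exponents_mul_layerPoly (hG : G.Connected) {d : ℕ}
    (P : MvPolynomial (V × Fin 2) ℂ) (s : Config G o d n) (τ : BdryConfig G o n) :
    coeff (exponents G o s τ) (P * layerPoly hG o n) =
      (if edgeExponents hG τ ≤ exponents G o s τ then
        coeff (exponents G o s τ - edgeExponents hG τ) P else 0) * singletSign τ := by
  classical
  rw [layerPoly_eq_sum_monomial, Finset.mul_sum, coeff_sum, Finset.sum_eq_single τ]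
  · rw [coeff_mul_monomial', ite_mul, zero_mul]
  · intro τ' _ hτ
    rw [coeff_mul_monomial', if_neg fun h => hτ (eq_of_edgeExponents_le_exponents hG h)]
  · simp

end SingletProduct

section ValenceBondRecursion

variable {V : Type*} {G : SimpleGraph V} [G.LocallyFinite] {o : V} {d n : ℕ}

/-- The normalization of the basis vector `√((d + 1) * d.choose j) * u ^ j * v ^ (d - j)`. -/
noncomputable def weylNorm (d j : ℕ) : ℝ := Real.sqrt (((d : ℝ) + 1) * (d.choose j : ℝ))

/-- The coefficient of `u ^ m * v ^ (d - m)` with respect to the `j`-th orthonormal basis vector of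
a site. -/
noncomputable def vertexAmplitude (d m j : ℕ) : ℝ := if j = m then (weylNorm d m)⁻¹ else 0

theorem vbs_apply (s : Config G o d n) (τ : BdryConfig G o n) :
    vbs G o d n s τ =
      (vbsPoly G o n).coeff (exponents G o s τ) * ∏ x, ((weylNorm d (s x) : ℝ) : ℂ)⁻¹ :=
  rfl

theorem prod_vertexAmplitude_eq_zero {ι : Type*} [Fintype ι] {m j : ι → ℕ}
    (h : ¬ ∀ x, j x = m x) : ∏ x, (vertexAmplitude d (m x) (j x) : ℂ) = 0 := by
  obtain ⟨x, hx⟩ := not_forall.1 h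
  exact Finset.prod_eq_zero (Finset.mem_univ x) (by simp [vertexAmplitude, hx])

variable [DecidableEq V]

/-- The matrix which passes from the boundary spins of `T_{n+1}` to those of `T_n`, when the spins
in layer `n + 1` are `r`: a vertex `x` of that layer with boundary spin `σ x` carries the monomial
`u ^ m * v ^ (d - m)`, where `m - σ x` of its children point down. -/
noncomputable def layerMatrix (hG : G.Connected) (d n : ℕ)
    (r : layer G o (n + 1) → Fin (d + 1)) :
    Matrix (BdryConfig G o n) (BdryConfig G o (n + 1)) ℂ :=
  Matrix.of fun σ τ =>
    singletSign τ * ∏ x, (vertexAmplitude d (childDownCount hG τ x + σ x) (r x) : ℂ)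

theorem vbs_succ (hG : G.IsTree) (hdeg : G.IsRegularOfDegree d)
    (r : layer G o (n + 1) → Fin (d + 1)) :
    (vbs G o d (n + 1)).submatrix (fun s => configSuccEquiv G o d n (s, r)) id =
      vbs G o d n * layerMatrix hG.1 d n r := by
  ext s τ
  rw [Matrix.submatrix_apply, id, vbs_apply, vbsPoly_succ hG, coeff_exponents_mul_layerPoly,
    Matrix.mul_apply]
  by_cases h : ∃ σ : BdryConfig G o n, ∀ x, (r x : ℕ) = childDownCount hG.1 τ x + σ x
  · obtain ⟨σ, hσ⟩ := h
    have unique_σ : ∀ σ' ≠ σ, ¬ ∀ x, (r x : ℕ) = childDownCount hG.1 τ x + σ' x :=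
      fun σ' hne h' => hne (funext fun x => by have := hσ x; have := h' x; omega)
    rw [exponents_configSuccEquiv_eq_add hG hdeg hσ, if_pos le_add_self, add_tsub_cancel_right,
      Finset.sum_eq_single σ _ (by simp), vbs_apply, layerMatrix, Matrix.of_apply,
      ← (ballSuccEquiv G o n).prod_comp, Fintype.prod_sum_type]
    · simp only [configSuccEquiv_inl, configSuccEquiv_inr, vertexAmplitude, hσ, if_pos,
        Complex.ofReal_inv]
      ring
    · intro σ' _ hne
      rw [layerMatrix, Matrix.of_apply, prod_vertexAmplitude_eq_zero (unique_σ σ' hne), mul_zero,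
        mul_zero]
  · rw [if_neg fun hle => h (exists_eq_childDownCount_add hG hdeg hle), zero_mul, zero_mul]
    refine (Finset.sum_eq_zero fun σ _ => ?_).symm
    rw [layerMatrix, Matrix.of_apply, prod_vertexAmplitude_eq_zero fun hσ => h ⟨σ, hσ⟩, mul_zero,
      mul_zero]

end ValenceBondRecursion

section Root

open MvPolynomial

variable {V : Type*} {G : SimpleGraph V} [G.LocallyFinite] {o : V} {d : ℕ}

instance uniqueBallZero : Unique (ball G o 0) where
  default := ⟨o, mem_ball_zero.2 rfl⟩
  uniq x := Subtype.ext (mem_ball_zero.1 x.2)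

theorem coe_ball_zero (x : ball G o 0) : (x : V) = o := mem_ball_zero.1 x.2

theorem edgeExponents_zero (hG : G.Connected) (τ : BdryConfig G o 0) :
    edgeExponents hG τ = siteExponents (G.degree o) o (downCount τ) +
      ∑ y : layer G o 1, siteExponents 1 (y : V) (τ y) := by
  rw [edgeExponents, Finset.sum_add_distrib, ← card_layer_one, ← Fintype.card_coe,
    ← sum_single_eq_siteExponents]
  congr 1
  · exact Finset.sum_congr rfl fun y _ => by rw [mem_layer_zero.1 (parent hG 0 y).2]
  · exact Finset.sum_congr rfl fun y _ => single_one_sub_eq_siteExponents _ _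

theorem exponents_zero (s : Config G o d 0) (τ : BdryConfig G o 0) :
    exponents G o s τ = siteExponents d o (s default) +
      ∑ y : layer G o 1, siteExponents 1 (y : V) (τ y) := by
  rw [exponents_eq_sum_siteExponents, Fintype.sum_unique, coe_ball_zero]

theorem vbs_zero (hG : G.IsTree) (hdeg : G.IsRegularOfDegree d) (s : Config G o d 0)
    (τ : BdryConfig G o 0) :
    vbs G o d 0 s τ = singletSign τ * (vertexAmplitude d (downCount τ) (s default) : ℂ) := by
  classical
  rw [vbs_apply, vbsPoly_zero hG, Fintype.prod_unique, ← one_mul (layerPoly _ _ _),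
    coeff_exponents_mul_layerPoly]
  by_cases h : (s default : ℕ) = downCount τ
  · rw [exponents_zero, edgeExponents_zero, hdeg o, h, if_pos le_rfl, tsub_self, coeff_zero_one,
      one_mul, vertexAmplitude, if_pos rfl, Complex.ofReal_inv]
  · have coeff_eq_zero : (if edgeExponents hG.1 τ ≤ exponents G o s τ then
        coeff (exponents G o s τ - edgeExponents hG.1 τ) (1 : MvPolynomial (V × Fin 2) ℂ)
        else 0) = 0 := by
      refine ite_eq_right_iff.2 fun hle => ?_
      rw [coeff_one, if_neg fun h0 => h ?_]
      have heq := le_antisymm (tsub_eq_zero_iff_le.1 h0.symm) hle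
      rw [exponents_zero, edgeExponents_zero, add_left_inj] at heq
      rw [← siteExponents_apply_zero d o (s default), heq, siteExponents_apply_zero]
    rw [coeff_eq_zero, vertexAmplitude, if_neg h]
    simp

end Root

section Weights

theorem weylNorm_sq (d j : ℕ) : weylNorm d j ^ 2 = ((d : ℝ) + 1) * (d.choose j : ℝ) :=
  Real.sq_sqrt (by positivity)

theorem weylNorm_pos {d j : ℕ} (h : j ≤ d) : 0 < weylNorm d j :=
  Real.sqrt_pos.2 (mul_pos (by positivity) (by exact_mod_cast Nat.choose_pos h))

theorem weylNorm_symm {d j : ℕ} (h : j ≤ d) : weylNorm d (d - j) = weylNorm d j := by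
  rw [weylNorm, weylNorm, Nat.choose_symm h]

/-- The weight which a vertex passes to its parent when all its children have the weight `b`. -/
noncomputable def transferWeight (d : ℕ) (b : Fin 2 → ℝ) (i : Fin 2) : ℝ :=
  ∑ j ∈ Finset.range d, ((d - 1).choose j : ℝ) *
    (b 0 ^ j * b 1 ^ (d - 1 - j) * (weylNorm d (j + i) ^ 2)⁻¹)

theorem transferWeight_comp_rev (d : ℕ) (b : Fin 2 → ℝ) (i : Fin 2) :
    transferWeight d (b ∘ Fin.rev) i = transferWeight d b i.rev := by
  rw [transferWeight, ← Finset.sum_range_reflect, transferWeight]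
  refine Finset.sum_congr rfl fun j hj => ?_
  have hj : j + 1 ≤ d := Finset.mem_range.1 hj
  have hi : d - 1 - j + (i : ℕ) = d - (j + (i.rev : ℕ)) := by rw [Fin.val_rev]; omega
  rw [Nat.choose_symm (by omega), show d - 1 - (d - 1 - j) = j by omega, hi,
    weylNorm_symm (by omega)]
  rw [Function.comp_apply, Function.comp_apply, show (0 : Fin 2).rev = 1 from rfl,
    show (1 : Fin 2).rev = 0 from rfl, mul_comm (b 1 ^ _)]

theorem choose_mul_inv_weylNorm_sq {d j : ℕ} (h : j < d) :
    ((d - 1).choose j : ℝ) * (weylNorm d j ^ 2)⁻¹ = ((d : ℝ) * (d + 1))⁻¹ * (d - j) := by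
  obtain ⟨m, rfl⟩ : ∃ m, d = m + 1 := ⟨d - 1, by omega⟩
  have choose_ne : ((m + 1).choose j : ℝ) ≠ 0 := by exact_mod_cast (Nat.choose_pos h.le).ne'
  have choose_mul : (m.choose j : ℝ) * (m + 1) = (m + 1).choose j * (m + 1 - j) := by
    rw [← Nat.cast_add_one, ← Nat.cast_sub h.le]
    exact_mod_cast Nat.choose_mul_succ_eq m j
  rw [weylNorm_sq, Nat.add_sub_cancel]
  push_cast
  field_simp
  linear_combination choose_mul

theorem choose_mul_inv_weylNorm_succ_sq {d j : ℕ} (h : j < d) :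
    ((d - 1).choose j : ℝ) * (weylNorm d (j + 1) ^ 2)⁻¹ = ((d : ℝ) * (d + 1))⁻¹ * (j + 1) := by
  have hsymm := choose_mul_inv_weylNorm_sq (show d - 1 - j < d by omega)
  rw [Nat.choose_symm (by omega), show d - 1 - j = d - (j + 1) by omega, weylNorm_symm h,
    Nat.cast_sub h] at hsymm
  rw [hsymm]
  push_cast
  ring

theorem sum_half_pow_sub (a : ℝ) (n : ℕ) :
    ∑ j ∈ Finset.range n, ((a - j) * (1 / 2) ^ (j + 1) - (j + 1) * (1 / 2 : ℝ) ^ j) =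
      a - 5 + (5 - a + 3 * n) * (1 / 2) ^ n := by
  induction n with
  | zero => norm_num
  | succ n ih =>
    rw [Finset.sum_range_succ, ih]
    push_cast
    ring

/-- At ratio `0` the right-hand side is larger, while at ratio `1 / 2` the difference of the two
sides is `d - 5 + (2 * d + 5) / 2 ^ d`. -/
theorem exists_weight_ratio {d : ℕ} (hd : 5 ≤ d) : ∃ r : ℝ, 0 < r ∧ r < 1 ∧
    r * ∑ j ∈ Finset.range d, ((d : ℝ) - j) * r ^ j =
      ∑ j ∈ Finset.range d, ((j : ℝ) + 1) * r ^ j := by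
  let f : ℝ → ℝ := fun r => ∑ j ∈ Finset.range d, (((d : ℝ) - j) * r ^ (j + 1) - (j + 1) * r ^ j)
  have hf : Continuous f := by fun_prop
  have hzero : f 0 < 0 := by
    obtain ⟨m, rfl⟩ : ∃ m, d = m + 1 := ⟨d - 1, by omega⟩
    simp [f, Finset.sum_range_succ']
  have hhalf : 0 < f (1 / 2) := by
    have : (5 : ℝ) ≤ d := by exact_mod_cast hd
    have : (0 : ℝ) < (5 - d + 3 * d) * (1 / 2) ^ d := mul_pos (by linarith) (by positivity)
    simp only [f, sum_half_pow_sub]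
    linarith
  obtain ⟨r, ⟨hr0, hr1⟩, hr⟩ :=
    intermediate_value_Ioo (by norm_num) hf.continuousOn ⟨hzero, hhalf⟩
  refine ⟨r, hr0, by linarith, ?_⟩
  rw [Finset.mul_sum, ← sub_eq_zero, ← Finset.sum_sub_distrib, ← hr]
  exact Finset.sum_congr rfl fun j _ => by ring

/-- The weights of spin down and spin up in the `k`-th layer of a Néel ordered state. -/
noncomputable def neelWeight (r : ℝ) (k : ℕ) (i : Fin 2) : ℝ := if Even (k + i) then r else 1

theorem neelWeight_pos {r : ℝ} (hr : 0 < r) (k : ℕ) (i : Fin 2) : 0 < neelWeight r k i := by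
  rw [neelWeight]; split_ifs <;> positivity

theorem neelWeight_succ (r : ℝ) (k : ℕ) : neelWeight r (k + 1) = neelWeight r k ∘ Fin.rev := by
  funext i
  obtain rfl | rfl : i = 0 ∨ i = 1 := by omega
  all_goals simp [neelWeight, Nat.even_add_one, Fin.rev]

theorem transferWeight_neelWeight {d : ℕ} {r : ℝ}
    (hr : r * ∑ j ∈ Finset.range d, ((d : ℝ) - j) * r ^ j =
      ∑ j ∈ Finset.range d, ((j : ℝ) + 1) * r ^ j) (k : ℕ) :
    transferWeight d (neelWeight r (k + 1)) =
      (((d : ℝ) * (d + 1))⁻¹ * ∑ j ∈ Finset.range d, ((d : ℝ) - j) * r ^ j) • neelWeight r k := by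
  induction k with
  | zero =>
    have neel_down : neelWeight r 0 0 = r := by simp [neelWeight]
    have neel_up : neelWeight r 0 1 = 1 := by simp [neelWeight]
    funext i
    rw [neelWeight_succ, transferWeight_comp_rev, transferWeight, Pi.smul_apply, smul_eq_mul,
      neel_down, neel_up]
    obtain rfl | rfl : i = 0 ∨ i = 1 := by omega
    · rw [neel_down, mul_assoc, mul_comm _ r, hr, Finset.mul_sum, show (0 : Fin 2).rev = 1 from rfl]
      refine Finset.sum_congr rfl fun j hj => ?_
      rw [← mul_assoc _ _ (r ^ j), ← choose_mul_inv_weylNorm_succ_sq (Finset.mem_range.1 hj),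
        one_pow, mul_one, mul_left_comm, mul_comm, Fin.val_one]
    · rw [neel_up, mul_one, Finset.mul_sum, show (1 : Fin 2).rev = 0 from rfl]
      refine Finset.sum_congr rfl fun j hj => ?_
      rw [← mul_assoc _ _ (r ^ j), ← choose_mul_inv_weylNorm_sq (Finset.mem_range.1 hj),
        one_pow, mul_one, mul_left_comm, mul_comm, Fin.val_zero, add_zero]
  | succ k ih =>
    funext i
    rw [neelWeight_succ, transferWeight_comp_rev, ih, neelWeight_succ r k]
    rfl

theorem exists_transferWeight_neelWeight_eq_smul {d : ℕ} (hd : 5 ≤ d) :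
    ∃ r c : ℝ, 0 < r ∧ r < 1 ∧ 0 < c ∧
      ∀ k, transferWeight d (neelWeight r (k + 1)) = c • neelWeight r k := by
  obtain ⟨r, hr0, hr1, hr⟩ := exists_weight_ratio hd
  refine ⟨r, _, hr0, hr1, ?_, transferWeight_neelWeight hr⟩
  have range_nonempty : (Finset.range d).Nonempty := ⟨0, Finset.mem_range.2 (by omega)⟩
  refine mul_pos (by positivity) (Finset.sum_pos (fun j hj => ?_) range_nonempty)
  have : (j : ℝ) < d := by exact_mod_cast Finset.mem_range.1 hj
  exact mul_pos (by linarith) (by positivity)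

end Weights

section Transfer

theorem sum_prod_fiberwise {ι κ α R : Type*} [Fintype ι] [DecidableEq ι] [Fintype κ]
    [DecidableEq κ] [Fintype α] [CommSemiring R] (p : κ → ι)
    (f : ∀ x : ι, ({y // p y = x} → α) → R) :
    ∑ τ : κ → α, ∏ x, f x (fun y => τ y) = ∏ x, ∑ τ : {y // p y = x} → α, f x τ := by
  rw [Finset.prod_univ_sum, Fintype.piFinset_univ]
  exact Fintype.sum_equiv ((Equiv.arrowCongr (Equiv.sigmaFiberEquiv p).symm (Equiv.refl α)).trans
    (Equiv.piCurry fun _ _ => α)) _ _ fun _ => rfl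

theorem prod_eq_pow_downCount_mul {κ R : Type*} [Fintype κ] [CommMonoid R] (b : Fin 2 → R)
    (τ : κ → Fin 2) :
    ∏ y, b (τ y) = b 0 ^ downCount τ * b 1 ^ (Fintype.card κ - downCount τ) := by
  classical
  rw [downCount, ← Finset.card_compl, Finset.compl_filter,
    ← Finset.prod_filter_mul_prod_filter_not Finset.univ fun y => τ y = 0]
  congr 1
  · exact Finset.prod_eq_pow_card fun y hy => by rw [(Finset.mem_filter.1 hy).2]
  · exact Finset.prod_eq_pow_card fun y hy => by
      rw [Fin.eq_one_of_ne_zero _ (Finset.mem_filter.1 hy).2]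

theorem sum_downCount {κ M : Type*} [Fintype κ] [DecidableEq κ] [AddCommMonoid M] (f : ℕ → M) :
    ∑ τ : κ → Fin 2, f (downCount τ) =
      ∑ j ∈ Finset.range (Fintype.card κ + 1), (Fintype.card κ).choose j • f j := by
  rw [← Finset.card_univ, ← Finset.sum_powerset_apply_card, Finset.powerset_univ]
  refine Finset.sum_bij' (fun τ _ => Finset.univ.filter fun y => τ y = 0)
    (fun s _ y => if y ∈ s then 0 else 1) (by simp) (by simp) (fun τ _ => ?_) (by simp) (by
      simp [downCount])
  funext y
  by_cases h : τ y = 0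
  · simp [h]
  · simp [Fin.eq_one_of_ne_zero _ h]

theorem sum_prod_mul_downCount {κ R : Type*} [Fintype κ] [DecidableEq κ] [CommSemiring R]
    (b : Fin 2 → R) (f : ℕ → R) :
    ∑ τ : κ → Fin 2, (∏ y, b (τ y)) * f (downCount τ) =
      ∑ j ∈ Finset.range (Fintype.card κ + 1),
        ((Fintype.card κ).choose j : R) * (b 0 ^ j * b 1 ^ (Fintype.card κ - j) * f j) := by
  simp_rw [prod_eq_pow_downCount_mul]
  rw [sum_downCount fun j => b 0 ^ j * b 1 ^ (Fintype.card κ - j) * f j]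
  simp_rw [nsmul_eq_mul]

theorem singletSign_mul_star {κ : Type*} [Fintype κ] (τ : κ → Fin 2) :
    singletSign τ * star (singletSign τ) = 1 := by
  simp only [singletSign, star_prod, star_pow, star_neg, star_one, ← Finset.prod_mul_distrib,
    ← mul_pow, neg_mul_neg, mul_one, one_pow, Finset.prod_const_one]

theorem sum_vertexAmplitude_mul {d m : ℕ} (hm : m < d) (i i' : Fin 2) :
    ∑ j : Fin (d + 1), vertexAmplitude d (m + i) j * vertexAmplitude d (m + i') j =
      if i = i' then (weylNorm d (m + i) ^ 2)⁻¹ else 0 := by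
  rw [Finset.sum_eq_single ⟨m + i, by omega⟩]
  · simp only [vertexAmplitude, Nat.add_left_cancel_iff, ← Fin.ext_iff]
    by_cases h : i = i'
    · rw [h, if_pos rfl, if_pos trivial, if_pos rfl, sq, mul_inv]
    · rw [if_neg h, if_neg h, mul_zero]
  · intro j _ hj
    rw [vertexAmplitude, if_neg fun h => hj (Fin.ext h), zero_mul]
  · simp

variable {V : Type*} {G : SimpleGraph V} [G.LocallyFinite] {o : V} {d n : ℕ}

/-- The product boundary condition on `T_n`, with weights `b 0` and `b 1` of spin down and up. -/
noncomputable def bdryProd (G : SimpleGraph V) [G.LocallyFinite] (o : V) (n : ℕ)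
    (b : Fin 2 → ℝ) : Matrix (BdryConfig G o n) (BdryConfig G o n) ℂ :=
  Matrix.diagonal fun τ => ∏ y, (b (τ y) : ℂ)

theorem bdryProd_smul (c : ℝ) (b : Fin 2 → ℝ) :
    bdryProd G o n (c • b) = (c : ℂ) ^ (layer G o (n + 1)).card • bdryProd G o n b := by
  rw [bdryProd, bdryProd, ← Matrix.diagonal_smul]
  congr 1
  funext τ
  simp [Finset.prod_mul_distrib]

theorem posSemidef_bdryProd {b : Fin 2 → ℝ} (hb : ∀ i, 0 ≤ b i) :
    (bdryProd G o n b).PosSemidef :=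
  Matrix.PosSemidef.diagonal fun τ =>
    Finset.prod_nonneg fun y _ => Complex.zero_le_real.2 (hb (τ y))

variable [DecidableEq V]

theorem sum_layerMatrix_mul_star (hG : G.IsTree) (hdeg : G.IsRegularOfDegree d)
    (σ σ' : BdryConfig G o n) (τ : BdryConfig G o (n + 1)) :
    ∑ r, layerMatrix hG.1 d n r σ τ * star (layerMatrix hG.1 d n r σ' τ) =
      ∏ x, if σ x = σ' x then
        (((weylNorm d (childDownCount hG.1 τ x + σ x) ^ 2)⁻¹ : ℝ) : ℂ) else 0 := by
  have childDownCount_lt (x) : childDownCount hG.1 τ x < d := by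
    have := card_parent_fiber_add_one hG x
    have := downCount_le_card fun y : {y // parent hG.1 (n + 1) y = x} => τ y
    have := hdeg x
    rw [childDownCount]
    omega
  calc ∑ r, layerMatrix hG.1 d n r σ τ * star (layerMatrix hG.1 d n r σ' τ)
      = ∑ r : layer G o (n + 1) → Fin (d + 1), ∏ x,
          ((vertexAmplitude d (childDownCount hG.1 τ x + σ x) (r x) *
            vertexAmplitude d (childDownCount hG.1 τ x + σ' x) (r x) : ℝ) : ℂ) := by
        refine Finset.sum_congr rfl fun r _ => ?_
        simp only [layerMatrix, Matrix.of_apply, star_mul', star_prod, Complex.star_def,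
          Complex.conj_ofReal]
        rw [mul_mul_mul_comm, ← Complex.star_def, singletSign_mul_star, one_mul,
          ← Finset.prod_mul_distrib]
        simp_rw [Complex.ofReal_mul]
    _ = ∏ x, ((∑ j : Fin (d + 1), vertexAmplitude d (childDownCount hG.1 τ x + σ x) j *
          vertexAmplitude d (childDownCount hG.1 τ x + σ' x) j : ℝ) : ℂ) := by
        simp_rw [Complex.ofReal_sum]
        rw [Finset.prod_univ_sum, Fintype.piFinset_univ]
    _ = _ := by
        refine Finset.prod_congr rfl fun x _ => ?_
        rw [sum_vertexAmplitude_mul (childDownCount_lt x)]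
        split_ifs <;> simp

/-- The boundary condition on `T_n` which induces on `T_n` the same state as the boundary condition
`B` on `T_{n+1}`. -/
noncomputable def transferMap (hG : G.Connected) (d : ℕ)
    (B : Matrix (BdryConfig G o (n + 1)) (BdryConfig G o (n + 1)) ℂ) :
    Matrix (BdryConfig G o n) (BdryConfig G o n) ℂ :=
  ∑ r : layer G o (n + 1) → Fin (d + 1),
    layerMatrix hG d n r * B * (layerMatrix hG d n r).conjTranspose

theorem transferMap_bdryProd (hG : G.IsTree) (hdeg : G.IsRegularOfDegree d) (b : Fin 2 → ℝ) :
    transferMap hG.1 d (bdryProd G o (n + 1) b) = bdryProd G o n (transferWeight d b) := by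
  ext σ σ'
  have sum_children (x : layer G o (n + 1)) :
      (∑ τ : {y // parent hG.1 (n + 1) y = x} → Fin 2, (∏ y, (b (τ y) : ℂ)) *
        if σ x = σ' x then (((weylNorm d (downCount τ + σ x) ^ 2)⁻¹ : ℝ) : ℂ) else 0) =
      if σ x = σ' x then (transferWeight d b (σ x) : ℂ) else 0 := by
    have card_children : Fintype.card {y // parent hG.1 (n + 1) y = x} + 1 = d :=
      (card_parent_fiber_add_one hG x).trans (hdeg x)
    split_ifs
    · rw [sum_prod_mul_downCount (fun i => (b i : ℂ))
        fun j => (((weylNorm d (j + σ x) ^ 2)⁻¹ : ℝ) : ℂ), card_children, transferWeight,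
        Nat.eq_sub_of_add_eq card_children]
      push_cast
      rfl
    · simp
  calc transferMap hG.1 d (bdryProd G o (n + 1) b) σ σ'
      = ∑ τ : BdryConfig G o (n + 1), (∏ y, (b (τ y) : ℂ)) *
          ∑ r, layerMatrix hG.1 d n r σ τ * star (layerMatrix hG.1 d n r σ' τ) := by
        simp_rw [transferMap, Matrix.sum_apply, Matrix.mul_apply (M := _ * _), bdryProd,
          Matrix.mul_diagonal, Matrix.conjTranspose_apply, Finset.mul_sum]
        rw [Finset.sum_comm]
        exact Finset.sum_congr rfl fun τ _ => Finset.sum_congr rfl fun r _ => by ring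
    _ = ∑ τ : BdryConfig G o (n + 1), ∏ x,
          ((∏ y : {y // parent hG.1 (n + 1) y = x}, (b (τ y) : ℂ)) * if σ x = σ' x then
            (((weylNorm d (childDownCount hG.1 τ x + σ x) ^ 2)⁻¹ : ℝ) : ℂ) else 0) := by
        refine Finset.sum_congr rfl fun τ _ => ?_
        rw [sum_layerMatrix_mul_star hG hdeg, Finset.prod_mul_distrib,
          Fintype.prod_fiberwise (parent hG.1 (n + 1)) fun y => (b (τ y) : ℂ)]
    _ = ∏ x, if σ x = σ' x then (transferWeight d b (σ x) : ℂ) else 0 :=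
        (sum_prod_fiberwise (parent hG.1 (n + 1)) fun x τ => (∏ y, (b (τ y) : ℂ)) *
          if σ x = σ' x then (((weylNorm d (downCount τ + σ x) ^ 2)⁻¹ : ℝ) : ℂ) else 0).trans
          (Finset.prod_congr rfl fun x _ => sum_children x)
    _ = bdryProd G o n (transferWeight d b) σ σ' := by
        rw [bdryProd, Matrix.diagonal_apply]
        split_ifs with h
        · simp [h]
        · obtain ⟨x, hx⟩ := Function.ne_iff.1 h
          exact Finset.prod_eq_zero (Finset.mem_univ x) (if_neg hx)

theorem embed_succ_apply (A : Obs G o d n) (s t : Config G o d n)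
    (r r' : layer G o (n + 1) → Fin (d + 1)) :
    embed G o n.le_succ A (configSuccEquiv G o d n (s, r)) (configSuccEquiv G o d n (t, r')) =
      if r = r' then A s t else 0 := by
  have restrict_eq (s : Config G o d n) (r : layer G o (n + 1) → Fin (d + 1)) (x : ball G o n) :
      configSuccEquiv G o d n (s, r) ⟨x, ball_mono G o n.le_succ x.2⟩ = s x :=
    configSuccEquiv_inl s r x
  simp only [embed, Matrix.of_apply, restrict_eq]
  refine if_congr ⟨fun h => funext fun x => ?_, ?_⟩ rfl rfl
  · simpa only [configSuccEquiv_inr] using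
      h (ballSuccEquiv G o n (.inr x)) fun hx => coe_ball_ne_coe_layer ⟨_, hx⟩ x rfl
  · rintro rfl z hz
    obtain ⟨x | x, rfl⟩ := (ballSuccEquiv G o n).surjective z
    · exact absurd x.2 hz
    · rw [configSuccEquiv_inr, configSuccEquiv_inr]

theorem trace_mul_embed_succ (M : Obs G o d (n + 1)) (A : Obs G o d n) :
    (M * embed G o n.le_succ A).trace =
      ∑ r, (M.submatrix (fun s => configSuccEquiv G o d n (s, r))
        (fun s => configSuccEquiv G o d n (s, r)) * A).trace := by
  simp only [Matrix.trace, Matrix.diag, Matrix.mul_apply, Matrix.submatrix_apply,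
    ← (configSuccEquiv G o d n).sum_comp, Fintype.sum_prod_type, embed_succ_apply,
    mul_ite, mul_zero, Finset.sum_ite_eq', Finset.mem_univ, if_true]
  exact Finset.sum_comm

theorem trace_vbs_succ_mul_embed (hG : G.IsTree) (hdeg : G.IsRegularOfDegree d)
    (B : Matrix (BdryConfig G o (n + 1)) (BdryConfig G o (n + 1)) ℂ) (A : Obs G o d n) :
    (vbs G o d (n + 1) * B * (vbs G o d (n + 1)).conjTranspose * embed G o n.le_succ A).trace =
      (vbs G o d n * transferMap hG.1 d B * (vbs G o d n).conjTranspose * A).trace := by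
  rw [trace_mul_embed_succ, ← Matrix.trace_sum, ← Finset.sum_mul]
  congr 2
  rw [transferMap, Matrix.mul_sum, Matrix.sum_mul]
  refine Finset.sum_congr rfl fun r _ => ?_
  rw [Matrix.submatrix_mul _ _ _ id _ Function.bijective_id,
    Matrix.submatrix_mul _ _ _ id _ Function.bijective_id, ← Matrix.conjTranspose_submatrix,
    vbs_succ hG hdeg, Matrix.submatrix_id_id, Matrix.conjTranspose_mul]
  simp only [Matrix.mul_assoc]

end Transfer

section OneSite

variable {d : ℕ}

theorem sqrt_mul_weylNorm {m : ℕ} (hm : m ≤ d) :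
    Real.sqrt (((d : ℝ) - m) * (m + 1)) * weylNorm d m = (m + 1) * weylNorm d (m + 1) := by
  have choose_succ : (d.choose (m + 1) : ℝ) * (m + 1) = d.choose m * (d - m) := by
    rw [← Nat.cast_sub hm]
    exact_mod_cast Nat.choose_succ_right_eq d m
  have hm' : (0 : ℝ) ≤ d - m := sub_nonneg.2 (by exact_mod_cast hm)
  rw [← pow_left_inj₀ (by unfold weylNorm; positivity) (by unfold weylNorm; positivity) two_ne_zero,
    mul_pow, mul_pow, Real.sq_sqrt (by positivity), weylNorm_sq, weylNorm_sq]
  linear_combination (-(d : ℝ) - 1) * (m + 1) * choose_succ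

theorem sqrt_mul_weylNorm_succ {m : ℕ} (hm : m ≤ d) :
    Real.sqrt (((d : ℝ) - m) * (m + 1)) * weylNorm d (m + 1) = (d - m) * weylNorm d m := by
  have hm' : (0 : ℝ) ≤ d - m := sub_nonneg.2 (by exact_mod_cast hm)
  have sq_sqrt := Real.mul_self_sqrt (show (0 : ℝ) ≤ (d - m) * (m + 1) by positivity)
  refine mul_left_cancel₀ (show (m : ℝ) + 1 ≠ 0 by positivity) ?_
  linear_combination weylNorm d m * sq_sqrt -
    Real.sqrt (((d : ℝ) - m) * (m + 1)) * sqrt_mul_weylNorm hm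

/-- `M` acts by `T` on the coefficients `f` of the vectors with components `weylNorm d k * f k`,
i.e. of the polynomials `∑ k, (d + 1) * d.choose k * f k * u ^ k * v ^ (d - k)`. The spin operators
have rational coefficients in this basis. -/
def ActsBy (M : Matrix (Fin (d + 1)) (Fin (d + 1)) ℂ) (T : (ℕ → ℂ) → ℕ → ℂ) : Prop :=
  ∀ (f : ℕ → ℂ) (i : Fin (d + 1)),
    ∑ k : Fin (d + 1), M i k * (weylNorm d k * f k) = weylNorm d i * T f i

theorem actsBy_spinPlus : ActsBy (spinPlus d) fun f i => i * f (i - 1) := fun f i => by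
  obtain ⟨i, hi⟩ := i
  cases i with
  | zero => simp [spinPlus]
  | succ m =>
    have hsqrt : (Real.sqrt (((d : ℝ) - m) * (m + 1)) : ℂ) * weylNorm d m =
        (m + 1) * weylNorm d (m + 1) := by
      exact_mod_cast sqrt_mul_weylNorm (Nat.le_of_succ_le (Fin.is_le ⟨m + 1, hi⟩))
    rw [Finset.sum_eq_single ⟨m, by omega⟩]
    · rw [spinPlus, Matrix.of_apply, if_pos rfl]
      simp only [Nat.add_sub_cancel]
      push_cast
      linear_combination f m * hsqrt
    · intro k _ hk
      rw [spinPlus, Matrix.of_apply, if_neg fun h => hk (Fin.ext (Nat.succ_injective h.symm)),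
        zero_mul]
    · simp

theorem actsBy_spinPlus_conjTranspose :
    ActsBy (spinPlus d).conjTranspose fun f i => (d - i) * f (i + 1) := fun f i => by
  rcases (Fin.is_le i).lt_or_eq with hi | hi
  · have hsqrt : (Real.sqrt (((d : ℝ) - (i : ℕ)) * ((i : ℕ) + 1)) : ℂ) * weylNorm d (i + 1) =
        (d - (i : ℕ)) * weylNorm d i := by exact_mod_cast sqrt_mul_weylNorm_succ hi.le
    rw [Finset.sum_eq_single ⟨i + 1, by omega⟩]
    · rw [Matrix.conjTranspose_apply, spinPlus, Matrix.of_apply, if_pos rfl, Complex.star_def,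
        Complex.conj_ofReal]
      linear_combination f (i + 1) * hsqrt
    · intro k _ hk
      rw [Matrix.conjTranspose_apply, spinPlus, Matrix.of_apply, if_neg fun h => hk (Fin.ext h),
        star_zero, zero_mul]
    · simp
  · simp only [hi, sub_self, zero_mul, mul_zero]
    refine Finset.sum_eq_zero fun k _ => ?_
    rw [Matrix.conjTranspose_apply, spinPlus, Matrix.of_apply, if_neg (by omega), star_zero,
      zero_mul]

theorem actsBy_spin_two : ActsBy (spin d 2) fun f i => (i - d / 2) * f i := fun f i => by
  rw [Finset.sum_eq_single i]
  · simp only [spin, Matrix.cons_val, Matrix.diagonal_apply_eq]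
    ring
  · intro k _ hk
    simp only [spin, Matrix.cons_val]
    rw [Matrix.diagonal_apply_ne _ hk.symm, zero_mul]
  · simp

end OneSite

section Hopping

/-- Each equation balances hops towards smaller and larger `i`. The former are absent at `i = 0`,
and if they vanish at `i` then so do the latter, which are the former at `i + 1`. -/
theorem eq_of_hopping_eq_zero {d : ℕ} {a : ℕ → ℕ → ℂ}
    (h : ∀ i ≤ d, ∀ j ≤ d, (i : ℂ) * (d - j) * (a (i - 1) (j + 1) - a i j) +
      (d - i) * j * (a (i + 1) (j - 1) - a i j) = 0) :
    ∀ i < d, ∀ j < d, a (i + 1) j = a i (j + 1) := by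
  have eq_of_inflow_eq_zero {i j : ℕ} (hi : i < d) (hj : j < d)
      (inflow : (i : ℂ) * (d - (j + 1 : ℕ)) * (a (i - 1) (j + 1 + 1) - a i (j + 1)) = 0) :
      a (i + 1) j = a i (j + 1) := by
    have outflow := h i hi.le (j + 1) hj
    rw [inflow, zero_add, Nat.add_sub_cancel] at outflow
    have d_sub_ne : (d : ℂ) - i ≠ 0 := sub_ne_zero.2 (by exact_mod_cast hi.ne')
    exact sub_eq_zero.1 ((mul_eq_zero.1 outflow).resolve_left
      (mul_ne_zero d_sub_ne (Nat.cast_ne_zero.2 j.succ_ne_zero)))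
  intro i
  induction i with
  | zero => exact fun hi j hj => eq_of_inflow_eq_zero hi hj (by simp)
  | succ m ih =>
    intro hi j hj
    refine eq_of_inflow_eq_zero hi hj ?_
    obtain hj | rfl : j + 1 < d ∨ j + 1 = d := by omega
    · rw [Nat.add_sub_cancel, ih (by omega) (j + 1) hj, sub_self, mul_zero]
    · rw [sub_self, mul_zero, zero_mul]

end Hopping

section Amplitude

variable {V : Type*} {G : SimpleGraph V} [G.LocallyFinite] {o : V} {d n : ℕ}

/-- The amplitudes of `w` in the configurations which agree with `s` outside `x` and `y` are given
by `a`, in the basis of `ActsBy` at both sites. -/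
def HasAmplitude (x y : ball G o n) (s : Config G o d n) (w : Config G o d n → ℂ)
    (a : ℕ → ℕ → ℂ) : Prop :=
  ∀ t : Config G o d n, (∀ z, z ≠ x → z ≠ y → t z = s z) →
    w t = weylNorm d (t x) * (weylNorm d (t y) * a (t x) (t y))

theorem exists_hasAmplitude (x y : ball G o n) (s : Config G o d n) (w : Config G o d n → ℂ) :
    ∃ a, HasAmplitude x y s w a := by
  classical
  refine ⟨fun k l => w (Function.update (Function.update s x (Fin.ofNat (d + 1) k)) y
    (Fin.ofNat (d + 1) l)) / (weylNorm d k * weylNorm d l), fun t ht => ?_⟩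
  have t_eq : Function.update (Function.update s x (t x)) y (t y) = t := by
    rw [Function.update_eq_iff]
    refine ⟨rfl, fun z hzy => ?_⟩
    by_cases hzx : z = x
    · rw [hzx, Function.update_self]
    · rw [Function.update_of_ne hzx, ht z hzx hzy]
  have weylNorm_ne (j : Fin (d + 1)) : (weylNorm d j : ℂ) ≠ 0 :=
    Complex.ofReal_ne_zero.2 (weylNorm_pos (Fin.is_le j)).ne'
  have := weylNorm_ne (t x)
  have := weylNorm_ne (t y)
  simp only [Fin.ofNat_eq_cast, Fin.cast_val_eq_self, t_eq]
  field_simp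

theorem HasAmplitude.add {x y : ball G o n} {s : Config G o d n} {w w' : Config G o d n → ℂ}
    {a a' : ℕ → ℕ → ℂ} (ha : HasAmplitude x y s w a) (ha' : HasAmplitude x y s w' a') :
    HasAmplitude x y s (w + w') (a + a') := fun t ht => by
  rw [Pi.add_apply, ha t ht, ha' t ht, Pi.add_apply, Pi.add_apply]
  ring

theorem HasAmplitude.smul {x y : ball G o n} {s : Config G o d n} {w : Config G o d n → ℂ}
    {a : ℕ → ℕ → ℂ} (c : ℂ) (ha : HasAmplitude x y s w a) :
    HasAmplitude x y s (c • w) (c • a) := fun t ht => by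
  rw [Pi.smul_apply, ha t ht, Pi.smul_apply, Pi.smul_apply, smul_eq_mul, smul_eq_mul]
  ring

theorem HasAmplitude.eq {x y : ball G o n} (hxy : x ≠ y) {s : Config G o d n}
    {w : Config G o d n → ℂ} {a a' : ℕ → ℕ → ℂ} (ha : HasAmplitude x y s w a)
    (ha' : HasAmplitude x y s w a') {k l : ℕ} (hk : k ≤ d) (hl : l ≤ d) : a k l = a' k l := by
  classical
  have weylNorm_ne {j : ℕ} (hj : j ≤ d) : (weylNorm d j : ℂ) ≠ 0 :=
    Complex.ofReal_ne_zero.2 (weylNorm_pos hj).ne'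
  let t : Config G o d n := Function.update (Function.update s x ⟨k, by omega⟩) y ⟨l, by omega⟩
  have t_x : (t x : ℕ) = k := by simp [t, hxy]
  have t_y : (t y : ℕ) = l := by simp [t]
  have ht z (hzx : z ≠ x) (hzy : z ≠ y) : t z = s z := by simp [t, hzx, hzy]
  have apply_eq := (ha t ht).symm.trans (ha' t ht)
  rw [t_x, t_y] at apply_eq
  exact mul_left_cancel₀ (weylNorm_ne hl) (mul_left_cancel₀ (weylNorm_ne hk) apply_eq)

end Amplitude

section PairOperators

theorem half_smul_add_sq_add_half_I_smul_sub_sq {R : Type*} [Ring R] [Algebra ℂ R] (P Q : R) :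
    ((1 / 2 : ℂ) • (P + Q)) ^ 2 + ((1 / (2 * Complex.I) : ℂ) • (P - Q)) ^ 2 =
      (1 / 2 : ℂ) • (P * Q + Q * P) := by
  have sq_half_I : (1 / (2 * Complex.I)) ^ 2 = -(1 / 4) := by
    rw [div_pow, mul_pow, Complex.I_sq]
    norm_num
  rw [smul_pow, smul_pow, sq_half_I, sq, sq, sq, add_mul, mul_add, mul_add, sub_mul, mul_sub,
    mul_sub]
  module

variable {V : Type*} [DecidableEq V] {G : SimpleGraph V} [G.LocallyFinite] {o : V} {d n : ℕ}

theorem siteOp_mulVec (x : ball G o n) (M : Matrix (Fin (d + 1)) (Fin (d + 1)) ℂ)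
    (w : Config G o d n → ℂ) (s : Config G o d n) :
    (siteOp G o x M).mulVec w s = ∑ k, M (s x) k * w (Function.update s x k) := by
  rw [Matrix.mulVec, dotProduct]
  symm
  refine Finset.sum_of_injOn (fun k => Function.update s x k) ?_ (by simp) ?_ ?_
  · exact (Function.update_injective s x).injOn
  · intro t _ ht
    rw [siteOp, Matrix.of_apply, if_neg, zero_mul]
    exact fun h => ht ⟨t x, by simp, Function.update_eq_iff.2 ⟨rfl, h⟩⟩
  · intro k _
    rw [siteOp, Matrix.of_apply, if_pos fun z hz => by rw [Function.update_of_ne hz],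
      Function.update_self]

/-- The action of a one-site operator on the two sites `x` and `y`, as of an element of the Lie
algebra. -/
noncomputable def pairOp (x y : ball G o n) :
    Matrix (Fin (d + 1)) (Fin (d + 1)) ℂ →ₗ[ℂ] Obs G o d n where
  toFun M := siteOp G o x M + siteOp G o y M
  map_add' M N := by
    ext s t
    simp only [siteOp, Matrix.add_apply, Matrix.of_apply]
    split_ifs <;> ring
  map_smul' c M := by
    ext s t
    simp only [siteOp, Matrix.add_apply, Matrix.smul_apply, Matrix.of_apply, smul_eq_mul,
      RingHom.id_apply]
    split_ifs <;> ring

theorem totalSpinSq_eq (x y : ball G o n) :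
    totalSpinSq (d := d) G o x y =
      (1 / 2 : ℂ) • (pairOp x y (spinPlus d) * pairOp x y (spinPlus d).conjTranspose +
        pairOp x y (spinPlus d).conjTranspose * pairOp x y (spinPlus d)) +
      pairOp x y (spin d 2) ^ 2 := by
  rw [← half_smul_add_sq_add_half_I_smul_sub_sq, ← map_add, ← map_sub, ← map_smul, ← map_smul,
    totalSpinSq, Fin.sum_univ_three]
  rfl

theorem HasAmplitude.pairOp_mulVec {x y : ball G o n} (hxy : x ≠ y) {s : Config G o d n}
    {w : Config G o d n → ℂ} {a : ℕ → ℕ → ℂ} (ha : HasAmplitude x y s w a)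
    {M : Matrix (Fin (d + 1)) (Fin (d + 1)) ℂ} {T : (ℕ → ℂ) → ℕ → ℂ} (hM : ActsBy M T) :
    HasAmplitude x y s ((pairOp x y M).mulVec w)
      fun k l => T (fun k => a k l) k + T (a k) l := by
  intro t ht
  have at_x (k : Fin (d + 1)) := ha (Function.update t x k) fun z hzx hzy => by
    rw [Function.update_of_ne hzx, ht z hzx hzy]
  have at_y (k : Fin (d + 1)) := ha (Function.update t y k) fun z hzx hzy => by
    rw [Function.update_of_ne hzy, ht z hzx hzy]
  simp only [Function.update_self, Function.update_of_ne hxy, Function.update_of_ne hxy.symm]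
    at at_x at_y
  rw [pairOp, LinearMap.coe_mk, AddHom.coe_mk, Matrix.add_mulVec, Pi.add_apply, siteOp_mulVec,
    siteOp_mulVec, mul_add, mul_add, ← hM (a (t x)) (t y), mul_left_comm,
    ← hM (fun k => a k (t y)) (t x), Finset.mul_sum, Finset.mul_sum]
  simp only [at_x, at_y]
  congr 1 <;> exact Finset.sum_congr rfl fun _ _ => by ring

/-- In the basis of `ActsBy` the bond operator `totalSpinSq - d * (d + 1)` generates a
hopping of units of spin between `x` and `y`. -/
theorem hopping_eq_zero_of_totalSpinSq_mulVec_eq {x y : ball G o n} (hxy : x ≠ y)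
    {s : Config G o d n} {w : Config G o d n → ℂ} {a : ℕ → ℕ → ℂ} (ha : HasAmplitude x y s w a)
    (hw : (totalSpinSq G o x y).mulVec w = ((d : ℂ) * (d + 1)) • w) {k l : ℕ} (hk : k ≤ d)
    (hl : l ≤ d) :
    (k : ℂ) * (d - l) * (a (k - 1) (l + 1) - a k l) +
      (d - k) * l * (a (k + 1) (l - 1) - a k l) = 0 := by
  have hplus {w a} (h : HasAmplitude x y s w a) := h.pairOp_mulVec hxy actsBy_spinPlus
  have hminus {w a} (h : HasAmplitude x y s w a) :=
    h.pairOp_mulVec hxy actsBy_spinPlus_conjTranspose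
  have hz {w a} (h : HasAmplitude x y s w a) := h.pairOp_mulVec hxy actsBy_spin_two
  have ha_total := (((hplus (hminus ha)).add (hminus (hplus ha))).smul (1 / 2)).add (hz (hz ha))
  simp only [Matrix.mulVec_mulVec, ← Matrix.add_mulVec, ← Matrix.smul_mulVec, ← sq,
    ← totalSpinSq_eq, hw] at ha_total
  have := ha_total.eq hxy (ha.smul ((d : ℂ) * (d + 1))) hk hl
  simp only [Pi.add_apply, Pi.smul_apply, smul_eq_mul] at this
  rcases k with _ | k <;> rcases l with _ | l <;>
    simp only [Nat.add_sub_cancel] at this ⊢ <;> push_cast at this ⊢ <;>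
    linear_combination this

theorem succ_left_eq_succ_right_of_totalSpinSq_mulVec_eq {x y : ball G o n} (hxy : x ≠ y)
    {s : Config G o d n} {w : Config G o d n → ℂ} {a : ℕ → ℕ → ℂ} (ha : HasAmplitude x y s w a)
    (hw : (totalSpinSq G o x y).mulVec w = ((d : ℂ) * (d + 1)) • w) {k l : ℕ} (hk : k < d)
    (hl : l < d) : a (k + 1) l = a k (l + 1) :=
  eq_of_hopping_eq_zero (fun _ hk _ hl => hopping_eq_zero_of_totalSpinSq_mulVec_eq hxy ha hw hk hl)
    k hk l hl

end PairOperators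

@[to_additive]
theorem prod_eq_mul_mul_prod_erase {ι M : Type*} [Fintype ι] [DecidableEq ι] [CommMonoid M]
    {x y : ι} (hxy : x ≠ y) (f : ι → M) :
    ∏ z, f z = f x * f y * ∏ z ∈ (Finset.univ.erase x).erase y, f z := by
  rw [← Finset.mul_prod_erase _ _ (Finset.mem_univ x),
    ← Finset.mul_prod_erase _ _ (Finset.mem_erase.2 ⟨hxy.symm, Finset.mem_univ y⟩), mul_assoc]

theorem siteExponents_succ_add_single {V : Type*} {m j : ℕ} (hj : j < m) (x : V) :
    siteExponents m x (j + 1) + Finsupp.single (x, 1) 1 =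
      siteExponents m x j + Finsupp.single (x, 0) 1 := by
  obtain ⟨k, rfl⟩ : ∃ k, m = j + 1 + k := ⟨m - (j + 1), by omega⟩
  rw [siteExponents, siteExponents, Finsupp.single_add, show j + 1 + k - (j + 1) = k by omega,
    show j + 1 + k - j = k + 1 by omega, Finsupp.single_add]
  abel

section Hop

open MvPolynomial (X coeff)

variable {V : Type*} {G : SimpleGraph V} [G.LocallyFinite] {o : V} {d n : ℕ}

theorem coeff_exponents_X_zero_mul {s : Config G o d n} {x : ball G o n} (hx : (s x : ℕ) = 0)
    (τ : BdryConfig G o n) (P : MvPolynomial (V × Fin 2) ℂ) :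
    coeff (exponents G o s τ) (X ((x : V), 0) * P) = 0 := by
  classical
  rw [MvPolynomial.coeff_X_mul', if_neg]
  rw [Finsupp.mem_support_iff, exponents_apply_ball, siteExponents_apply_zero, hx]
  exact fun h => h rfl

theorem coeff_exponents_X_one_mul {s : Config G o d n} {x : ball G o n} (hx : (s x : ℕ) = d)
    (τ : BdryConfig G o n) (P : MvPolynomial (V × Fin 2) ℂ) :
    coeff (exponents G o s τ) (X ((x : V), 1) * P) = 0 := by
  classical
  rw [MvPolynomial.coeff_X_mul', if_neg]
  rw [Finsupp.mem_support_iff, exponents_apply_ball, siteExponents_apply_one, hx, Nat.sub_self]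
  exact fun h => h rfl

theorem lt_and_pos_of_coeff_ne_zero {x y : ball G o n} {s : Config G o d n} {τ : BdryConfig G o n}
    {Q : MvPolynomial (V × Fin 2) ℂ}
    (h : coeff (exponents G o s τ) (X ((x : V), 1) * X ((y : V), 0) * Q) ≠ 0) :
    (s x : ℕ) < d ∧ 0 < (s y : ℕ) := by
  refine ⟨(Fin.is_le (s x)).lt_of_ne fun hx => h ?_, Nat.pos_of_ne_zero fun hy => h ?_⟩
  · rw [mul_assoc, coeff_exponents_X_one_mul hx]
  · rw [mul_right_comm, mul_comm, coeff_exponents_X_zero_mul hy]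

theorem exists_vbsPoly_eq_mul {x y : ball G o n} (hxy : IsEdge G o x y) :
    ∃ Q, vbsPoly G o n =
      (X ((x : V), 0) * X ((y : V), 1) - X ((x : V), 1) * X ((y : V), 0)) * Q := by
  have factor_dvd := Finset.dvd_prod_of_mem (fun y' : V => open Classical in
    if IsEdge G o x y' then (X ((x : V), 0) * X (y', 1) - X ((x : V), 1) * X (y', 0) :
      MvPolynomial (V × Fin 2) ℂ) else 1) (ball_mono G o n.le_succ y.2)
  simp only [if_pos hxy] at factor_dvd
  exact factor_dvd.trans (Finset.dvd_prod_of_mem (fun x' => ∏ y' ∈ ball G o (n + 1),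
    open Classical in if IsEdge G o x' y' then (X (x', 0) * X (y', 1) - X (x', 1) * X (y', 0) :
      MvPolynomial (V × Fin 2) ℂ) else 1) x.2)

variable [DecidableEq V]

/-- The configuration in which one unit of spin is moved from `y` to `x`. It is meaningful for
`s x < d` and `0 < s y`, otherwise the arithmetic in `Fin (d + 1)` is truncated or wraps around. -/
def hop (x y : ball G o n) (s : Config G o d n) : Config G o d n :=
  Function.update (Function.update s x (Fin.ofNat (d + 1) (s x + 1))) y
    (Fin.ofNat (d + 1) (s y - 1))

theorem hop_apply_left {x y : ball G o n} (hxy : x ≠ y) {s : Config G o d n}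
    (hx : (s x : ℕ) < d) : (hop x y s x : ℕ) = s x + 1 := by
  rw [hop, Function.update_of_ne hxy, Function.update_self, Fin.val_ofNat,
    Nat.mod_eq_of_lt (by omega)]

theorem hop_apply_right (x y : ball G o n) (s : Config G o d n) :
    (hop x y s y : ℕ) = s y - 1 := by
  rw [hop, Function.update_self, Fin.val_ofNat, Nat.mod_eq_of_lt (by omega)]

theorem hop_apply_of_ne {x y z : ball G o n} (hx : z ≠ x) (hy : z ≠ y) (s : Config G o d n) :
    hop x y s z = s z := by
  rw [hop, Function.update_of_ne hy, Function.update_of_ne hx]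

theorem hop_hop {x y : ball G o n} (hxy : x ≠ y) {s : Config G o d n}
    (hx : (s x : ℕ) < d) (hy : 0 < (s y : ℕ)) : hop y x (hop x y s) = s := by
  have hop_x := hop_apply_left hxy hx
  have hop_y := hop_apply_right x y s
  have := (s y).isLt
  funext z
  by_cases hzx : z = x
  · subst hzx
    refine Fin.ext ?_
    rw [hop_apply_right, hop_x, Nat.add_sub_cancel]
  by_cases hzy : z = y
  · subst hzy
    refine Fin.ext ?_
    rw [hop_apply_left hxy.symm (by omega), hop_y, Nat.sub_add_cancel hy]
  rw [hop_apply_of_ne hzy hzx, hop_apply_of_ne hzx hzy]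

@[to_additive]
theorem prod_erase_hop {M : Type*} [CommMonoid M] (x y : ball G o n) (s : Config G o d n)
    (f : ball G o n → Fin (d + 1) → M) :
    ∏ z ∈ (Finset.univ.erase x).erase y, f z (hop x y s z) =
      ∏ z ∈ (Finset.univ.erase x).erase y, f z (s z) :=
  Finset.prod_congr rfl fun z hz => by
    obtain ⟨hzy, hzx, -⟩ : z ≠ y ∧ z ≠ x ∧ _ := by
      simpa only [Finset.mem_erase] using hz
    rw [hop_apply_of_ne hzx hzy]

theorem exponents_hop {x y : ball G o n} (hxy : x ≠ y) {s : Config G o d n} (hx : (s x : ℕ) < d)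
    (hy : 0 < (s y : ℕ)) (τ : BdryConfig G o n) :
    exponents G o (hop x y s) τ +
        (Finsupp.single ((x : V), 1) 1 + Finsupp.single ((y : V), 0) 1) =
      exponents G o s τ + (Finsupp.single ((x : V), 0) 1 + Finsupp.single ((y : V), 1) 1) := by
  have site_x := siteExponents_succ_add_single hx (x : V)
  have site_y := siteExponents_succ_add_single (m := d) (j := s y - 1) (by omega) (y : V)
  rw [Nat.sub_add_cancel hy] at site_y
  rw [exponents_eq_sum_siteExponents, exponents_eq_sum_siteExponents,
    sum_eq_add_add_sum_erase hxy fun z => siteExponents d (z : V) (hop x y s z),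
    sum_eq_add_add_sum_erase hxy fun z => siteExponents d (z : V) (s z),
    sum_erase_hop x y s fun z j => siteExponents d (z : V) j, hop_apply_left hxy hx,
    hop_apply_right]
  calc
    _ = (siteExponents d (x : V) (s x + 1) + Finsupp.single ((x : V), 1) 1) +
        (siteExponents d (y : V) (s y - 1) + Finsupp.single ((y : V), 0) 1) +
        (∑ z ∈ (Finset.univ.erase x).erase y, siteExponents d (z : V) (s z) +
          ∑ z : layer G o (n + 1), siteExponents 1 (z : V) (τ z)) := by abel
    _ = _ := by
      rw [site_x, ← site_y]
      abel

theorem coeff_hop {x y : ball G o n} (hxy : x ≠ y) {s : Config G o d n} (hx : (s x : ℕ) < d)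
    (hy : 0 < (s y : ℕ)) (τ : BdryConfig G o n) (Q : MvPolynomial (V × Fin 2) ℂ) :
    coeff (exponents G o (hop x y s) τ) (X ((x : V), 0) * X ((y : V), 1) * Q) =
      coeff (exponents G o s τ) (X ((x : V), 1) * X ((y : V), 0) * Q) := by
  have coeff_X_mul_X_mul (m : V × Fin 2 →₀ ℕ) (p q : V × Fin 2) (P : MvPolynomial (V × Fin 2) ℂ) :
      coeff (m + (Finsupp.single p 1 + Finsupp.single q 1)) (X p * X q * P) = coeff m P := by
    rw [X, X, MvPolynomial.monomial_mul, one_mul, add_comm m, MvPolynomial.coeff_monomial_mul,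
      one_mul]
  rw [← coeff_X_mul_X_mul (exponents G o (hop x y s) τ) (x, 1) (y, 0), exponents_hop hxy hx hy,
    mul_left_comm, coeff_X_mul_X_mul]

/-- Hopping exchanges the terms of the two monomials of the singlet `u_x v_y - v_x u_y`. -/
theorem sum_mul_coeff_singlet_mul_eq_zero {x y : ball G o n} (hxy : x ≠ y) {g : Config G o d n → ℂ}
    (hg : ∀ s : Config G o d n, (s x : ℕ) < d → 0 < (s y : ℕ) → g (hop x y s) = g s)
    (Q : MvPolynomial (V × Fin 2) ℂ) (τ : BdryConfig G o n) :
    ∑ s, g s * coeff (exponents G o s τ)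
      ((X ((x : V), 0) * X ((y : V), 1) - X ((x : V), 1) * X ((y : V), 0)) * Q) = 0 := by
  simp_rw [sub_mul, MvPolynomial.coeff_sub, mul_sub]
  rw [Finset.sum_sub_distrib, sub_eq_zero]
  have apply_of_ne_zero {x y : ball G o n} {s : Config G o d n}
      (h : g s * coeff (exponents G o s τ) (X ((x : V), 1) * X ((y : V), 0) * Q) ≠ 0) :
      (s x : ℕ) < d ∧ 0 < (s y : ℕ) :=
    lt_and_pos_of_coeff_ne_zero (right_ne_zero_of_mul h)
  have term_hop (s : Config G o d n) (hs : (s x : ℕ) < d ∧ 0 < (s y : ℕ)) :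
      g (hop x y s) * coeff (exponents G o (hop x y s) τ) (X ((x : V), 0) * X ((y : V), 1) * Q) =
        g s * coeff (exponents G o s τ) (X ((x : V), 1) * X ((y : V), 0) * Q) := by
    rw [hg s hs.1 hs.2, coeff_hop hxy hs.1 hs.2]
  symm
  refine Finset.sum_bij_ne_zero (fun s _ _ => hop x y s) (fun _ _ _ => Finset.mem_univ _) ?_ ?_
    fun s _ hs => (term_hop s (apply_of_ne_zero hs)).symm
  · intro s _ hs t _ ht hst
    obtain ⟨hsx, hsy⟩ := apply_of_ne_zero hs
    obtain ⟨htx, hty⟩ := apply_of_ne_zero ht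
    rw [← hop_hop hxy hsx hsy, hst, hop_hop hxy htx hty]
  · intro t _ ht
    obtain ⟨hty, htx⟩ := apply_of_ne_zero (x := y) (y := x) (by rwa [mul_comm (X _) (X _)])
    have hop_hop_t := hop_hop hxy.symm hty htx
    have hop_x := hop_apply_right y x t
    have hop_y := hop_apply_left hxy.symm hty
    have := (t x).isLt
    refine ⟨hop y x t, Finset.mem_univ _, ?_, hop_hop_t⟩
    rwa [← term_hop _ ⟨by omega, by omega⟩, hop_hop_t]

theorem mul_prod_inv_weylNorm_hop {x y : ball G o n} (hxy : x ≠ y) {w : Config G o d n → ℂ}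
    (hw : (totalSpinSq G o x y).mulVec w = ((d : ℂ) * (d + 1)) • w) {s : Config G o d n}
    (hx : (s x : ℕ) < d) (hy : 0 < (s y : ℕ)) :
    w (hop x y s) * ∏ z, (weylNorm d (hop x y s z) : ℂ)⁻¹ =
      w s * ∏ z, (weylNorm d (s z) : ℂ)⁻¹ := by
  obtain ⟨a, ha⟩ := exists_hasAmplitude x y s w
  have ha_hop : a (hop x y s x) (hop x y s y) = a (s x) (s y) := by
    rw [hop_apply_left hxy hx, hop_apply_right,
      succ_left_eq_succ_right_of_totalSpinSq_mulVec_eq hxy ha hw hx (by omega),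
      Nat.sub_add_cancel hy]
  have cancel (t : Config G o d n) (ht : ∀ z, z ≠ x → z ≠ y → t z = s z) :
      w t * (weylNorm d (t x) : ℂ)⁻¹ * (weylNorm d (t y) : ℂ)⁻¹ = a (t x) (t y) := by
    have weylNorm_ne (j : Fin (d + 1)) : (weylNorm d j : ℂ) ≠ 0 :=
      Complex.ofReal_ne_zero.2 (weylNorm_pos (Fin.is_le j)).ne'
    have := weylNorm_ne (t x)
    have := weylNorm_ne (t y)
    rw [ha t ht]
    field_simp
  rw [prod_eq_mul_mul_prod_erase hxy fun z => (weylNorm d (hop x y s z) : ℂ)⁻¹,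
    prod_eq_mul_mul_prod_erase hxy fun z => (weylNorm d (s z) : ℂ)⁻¹,
    prod_erase_hop x y s fun _ j => (weylNorm d j : ℂ)⁻¹]
  simp only [← mul_assoc]
  rw [cancel _ fun z hzx hzy => hop_apply_of_ne hzx hzy s, cancel s fun _ _ _ => rfl, ha_hop]

theorem sum_star_mul_vbs_eq_zero {x y : ball G o n} (hxy : IsEdge G o x y)
    {w : Config G o d n → ℂ}
    (hw : (totalSpinSq G o x y).mulVec w = ((d : ℂ) * (d + 1)) • w) (τ : BdryConfig G o n) :
    ∑ s, star (w s) * vbs G o d n s τ = 0 := by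
  have hne : x ≠ y := fun h => G.loopless.irrefl _ (h ▸ hxy.1)
  obtain ⟨Q, hQ⟩ := exists_vbsPoly_eq_mul hxy
  have star_hop (s : Config G o d n) (hx : (s x : ℕ) < d) (hy : 0 < (s y : ℕ)) :
      star (w (hop x y s)) * ∏ z, (weylNorm d (hop x y s z) : ℂ)⁻¹ =
        star (w s) * ∏ z, (weylNorm d (s z) : ℂ)⁻¹ := by
    have := congrArg star (mul_prod_inv_weylNorm_hop hne hw hx hy)
    simpa only [star_mul', star_prod, star_inv₀, Complex.star_def, Complex.conj_ofReal] using this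
  rw [← sum_mul_coeff_singlet_mul_eq_zero hne (g := fun s => star (w s) *
    ∏ z, (weylNorm d (s z) : ℂ)⁻¹) star_hop Q τ, ← hQ]
  exact Finset.sum_congr rfl fun s _ => by
    rw [vbs_apply]
    ring

theorem hamiltonian_apply_eq_zero (M : Matrix (BdryConfig G o n) (Config G o d n) ℂ)
    (φ : EuclideanSpace ℂ (Config G o d n)) :
    hamiltonian G o d n (Matrix.toEuclideanLin (vbs G o d n * M) φ) = 0 := by
  rw [hamiltonian, sum_apply]
  refine Finset.sum_eq_zero fun x _ => ?_
  rw [sum_apply]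
  refine Finset.sum_eq_zero fun y _ => ?_
  split_ifs with hxy
  · rw [Submodule.starProjection_apply_eq_zero_iff, Submodule.mem_orthogonal]
    intro w hw
    have mulVec_w : (totalSpinSq G o x y).mulVec w.ofLp = ((d : ℂ) * (d + 1)) • w.ofLp :=
      congrArg WithLp.ofLp (Module.End.mem_eigenspace_iff.1 hw)
    have vecMul_vbs : Matrix.vecMul (star w.ofLp) (vbs G o d n) = 0 :=
      funext fun τ => sum_star_mul_vbs_eq_zero hxy mulVec_w τ
    rw [Matrix.toLpLin_apply, ← Matrix.mulVec_mulVec, EuclideanSpace.inner_eq_star_dotProduct,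
      dotProduct_comm, Matrix.dotProduct_mulVec, vecMul_vbs, zero_dotProduct]
  · rfl

end Hop

section Trace

variable {ι : Type*} [Fintype ι]

open scoped MatrixOrder Matrix.Norms.L2Operator in
theorem exists_eq_conjTranspose_mul_self {ρ : Matrix ι ι ℂ} (hρ : ρ.PosSemidef) :
    ∃ C : Matrix ι ι ℂ, ρ = C.conjTranspose * C := by
  classical
  exact CStarAlgebra.nonneg_iff_eq_star_mul_self.mp hρ.nonneg

variable [DecidableEq ι]

theorem norm_trace_mul_le_of_posSemidef {ρ : Matrix ι ι ℂ} (hρ : ρ.PosSemidef)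
    (A : Matrix ι ι ℂ) :
    ‖(ρ * A).trace‖ ≤ ‖ρ.trace‖ * ‖Matrix.toEuclideanCLM (𝕜 := ℂ) A‖ := by
  obtain ⟨C, rfl⟩ := exists_eq_conjTranspose_mul_self hρ
  let c (i : ι) : EuclideanSpace ℂ ι := WithLp.toLp 2 (star (C i))
  have trace_eq_sum_inner (A : Matrix ι ι ℂ) : (C.conjTranspose * C * A).trace =
      ∑ i, inner ℂ (c i) (Matrix.toEuclideanCLM (𝕜 := ℂ) A (c i)) := by
    rw [mul_assoc, Matrix.trace_mul_comm, mul_assoc, Matrix.trace]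
    refine Finset.sum_congr rfl fun i _ => ?_
    rw [Matrix.toEuclideanCLM_toLp, EuclideanSpace.inner_toLp_toLp, star_star, dotProduct_comm]
    rfl
  have trace_eq : (C.conjTranspose * C).trace = ((∑ i, ‖c i‖ ^ 2 : ℝ) : ℂ) := by
    have := trace_eq_sum_inner 1
    simp only [mul_one, map_one, one_apply_eq_self, inner_self_eq_norm_sq_to_K] at this
    rw [this]
    push_cast
    rfl
  calc
    _ ≤ ∑ i, ‖c i‖ * (‖Matrix.toEuclideanCLM (𝕜 := ℂ) A‖ * ‖c i‖) := by
      rw [trace_eq_sum_inner]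
      refine norm_sum_le_of_le _ fun i _ => (norm_inner_le_norm _ _).trans ?_
      gcongr
      exact ContinuousLinearMap.le_opNorm _ _
    _ = (∑ i, ‖c i‖ ^ 2) * ‖Matrix.toEuclideanCLM (𝕜 := ℂ) A‖ := by
      rw [Finset.sum_mul]
      exact Finset.sum_congr rfl fun i _ => by ring
    _ = _ := by
      rw [trace_eq, Complex.norm_of_nonneg (Finset.sum_nonneg fun i _ => sq_nonneg _)]

end Trace

section Embed

variable {V : Type*} [DecidableEq V] {G : SimpleGraph V} [G.LocallyFinite] {o : V} {d n : ℕ}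

theorem embed_refl (A : Obs G o d n) : embed G o le_rfl A = A := by
  ext s t
  rw [embed, Matrix.of_apply, if_pos]
  exact fun z hz => absurd z.2 hz

theorem embed_embed {k m : ℕ} (h : k ≤ m) (h' : m ≤ n) (A : Obs G o d k) :
    embed G o h' (embed G o h A) = embed G o (h.trans h') A := by
  ext s t
  simp only [embed, Matrix.of_apply]
  rw [← ite_and]
  refine if_congr ⟨?_, fun eq_off => ?_⟩ rfl rfl
  · rintro ⟨eq_off_m, eq_on_m⟩ z hz
    by_cases hzm : (z : V) ∈ ball G o m
    · exact eq_on_m ⟨z, hzm⟩ hz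
    · exact eq_off_m z hzm
  · exact ⟨fun z hz => eq_off z fun hzk => hz (ball_mono G o h hzk), fun z hz => eq_off _ hz⟩

theorem embed_one {m : ℕ} (h : m ≤ n) : embed G o h (1 : Obs G o d m) = 1 := by
  ext s t
  simp only [embed, Matrix.of_apply, Matrix.one_apply]
  rw [← ite_and]
  refine if_congr ⟨?_, ?_⟩ rfl rfl
  · rintro ⟨eq_off, eq_on⟩
    funext z
    by_cases hz : (z : V) ∈ ball G o m
    · exact congrFun eq_on ⟨z, hz⟩
    · exact eq_off z hz
  · rintro rfl
    exact ⟨fun _ _ => rfl, rfl⟩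

/-- The element of the quasi-local algebra which is represented by the observable `A` of `T_m`. Its
components in the volumes smaller than `T_m` are irrelevant and set to `0`. -/
noncomputable def QuasiLocalObs.ofLocal {m : ℕ} (A : Obs G o d m) : QuasiLocalObs G o d where
  obs n := if h : m ≤ n then embed G o h A else 0
  cauchy ε hε := ⟨m, fun n h => by
    rw [dif_pos h, dif_pos le_rfl, embed_embed, sub_self, map_zero, norm_zero]
    exact hε.le⟩

theorem QuasiLocalObs.ofLocal_obs {m : ℕ} (h : m ≤ n) (A : Obs G o d m) :
    (ofLocal A).obs n = embed G o h A :=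
  dif_pos h

end Embed

section GroundState

variable {V : Type*} [DecidableEq V] {G : SimpleGraph V} [G.LocallyFinite] {o : V} {d n : ℕ}

theorem isFiniteVolumeGroundState_density {B : Matrix (BdryConfig G o n) (BdryConfig G o n) ℂ}
    (hB : B.PosSemidef)
    (trace_ne : (vbs G o d n * B * (vbs G o d n).conjTranspose).trace ≠ 0) :
    IsFiniteVolumeGroundState G o (density (d := d) G o B) := by
  have posSemidef := hB.mul_mul_conjTranspose_same (vbs G o d n)
  refine ⟨posSemidef.smul (inv_nonneg.2 posSemidef.trace_nonneg), ?_, fun φ => ?_⟩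
  · rw [density, Matrix.trace_smul, smul_eq_mul, inv_mul_cancel₀ trace_ne]
  · rw [density, Matrix.mul_assoc, ← Matrix.mul_smul, hamiltonian_apply_eq_zero]

section Consistent

variable {B' : Matrix (BdryConfig G o (n + 1)) (BdryConfig G o (n + 1)) ℂ}
  {B : Matrix (BdryConfig G o n) (BdryConfig G o n) ℂ} {c : ℂ}

theorem trace_vbs_succ_mul_embed_of_transferMap_eq_smul (hG : G.IsTree)
    (hdeg : G.IsRegularOfDegree d) (hB : transferMap hG.1 d B' = c • B) (A : Obs G o d n) :
    (vbs G o d (n + 1) * B' * (vbs G o d (n + 1)).conjTranspose * embed G o n.le_succ A).trace =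
      c * (vbs G o d n * B * (vbs G o d n).conjTranspose * A).trace := by
  rw [trace_vbs_succ_mul_embed hG hdeg, hB, Matrix.mul_smul, Matrix.smul_mul, Matrix.smul_mul,
    Matrix.trace_smul, smul_eq_mul]

theorem trace_vbs_succ_of_transferMap_eq_smul (hG : G.IsTree) (hdeg : G.IsRegularOfDegree d)
    (hB : transferMap hG.1 d B' = c • B) :
    (vbs G o d (n + 1) * B' * (vbs G o d (n + 1)).conjTranspose).trace =
      c * (vbs G o d n * B * (vbs G o d n).conjTranspose).trace := by
  simpa only [embed_one, mul_one] using
    trace_vbs_succ_mul_embed_of_transferMap_eq_smul hG hdeg hB 1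

theorem trace_density_succ_mul_embed (hG : G.IsTree) (hdeg : G.IsRegularOfDegree d) (hc : c ≠ 0)
    (hB : transferMap hG.1 d B' = c • B) (A : Obs G o d n) :
    (density G o B' * embed G o n.le_succ A).trace = (density G o B * A).trace := by
  rw [density, density, smul_mul_assoc, smul_mul_assoc, Matrix.trace_smul, Matrix.trace_smul,
    smul_eq_mul, smul_eq_mul, trace_vbs_succ_of_transferMap_eq_smul hG hdeg hB,
    trace_vbs_succ_mul_embed_of_transferMap_eq_smul hG hdeg hB, mul_inv, mul_mul_mul_comm,
    inv_mul_cancel₀ hc, one_mul]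

end Consistent

variable {B : ∀ n, Matrix (BdryConfig G o n) (BdryConfig G o n) ℂ} {c : ℕ → ℂ}

theorem trace_vbs_ne_zero (hG : G.IsTree) (hdeg : G.IsRegularOfDegree d) (hc : ∀ n, c n ≠ 0)
    (hB : ∀ n, transferMap hG.1 d (B (n + 1)) = c n • B n)
    (trace_ne : (vbs G o d 0 * B 0 * (vbs G o d 0).conjTranspose).trace ≠ 0) (n : ℕ) :
    (vbs G o d n * B n * (vbs G o d n).conjTranspose).trace ≠ 0 := by
  induction n with
  | zero => exact trace_ne
  | succ n ih =>
    rw [trace_vbs_succ_of_transferMap_eq_smul hG hdeg (hB n)]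
    exact mul_ne_zero (hc n) ih

theorem trace_density_mul_embed (hG : G.IsTree) (hdeg : G.IsRegularOfDegree d)
    (hc : ∀ n, c n ≠ 0) (hB : ∀ n, transferMap hG.1 d (B (n + 1)) = c n • B n) {m n : ℕ}
    (h : m ≤ n) (A : Obs G o d m) :
    (density G o (B n) * embed G o h A).trace = (density G o (B m) * A).trace := by
  induction n, h using Nat.le_induction with
  | base => rw [embed_refl]
  | succ n hmn ih =>
    rw [← embed_embed hmn n.le_succ, trace_density_succ_mul_embed hG hdeg (hc n) (hB n), ih]

theorem exists_isInfiniteVolumeGroundState (hG : G.IsTree) (hdeg : G.IsRegularOfDegree d)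
    (hc : ∀ n, c n ≠ 0) (hB : ∀ n, transferMap hG.1 d (B (n + 1)) = c n • B n)
    (posSemidef : ∀ n, (B n).PosSemidef)
    (trace_ne : (vbs G o d 0 * B 0 * (vbs G o d 0).conjTranspose).trace ≠ 0) :
    ∃ ω : QuasiLocalObs G o d → ℂ, IsInfiniteVolumeGroundState G o ω ∧
      ∀ (m : ℕ) (A : Obs G o d m),
        ω (QuasiLocalObs.ofLocal A) = (density G o (B m) * A).trace := by
  have isGroundState (n) : IsFiniteVolumeGroundState G o (density (d := d) G o (B n)) :=
    isFiniteVolumeGroundState_density (posSemidef n) (trace_vbs_ne_zero hG hdeg hc hB trace_ne n)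
  have exists_limit (A : QuasiLocalObs G o d) : ∃ z, Filter.Tendsto
      (fun n => (density (d := d) G o (B n) * A.obs n).trace) Filter.atTop (nhds z) := by
    refine cauchySeq_tendsto_of_complete (Metric.cauchySeq_iff'.2 fun ε hε => ?_)
    obtain ⟨N, hN⟩ := A.cauchy (ε / 2) (half_pos hε)
    refine ⟨N, fun n hn => ?_⟩
    obtain ⟨density_posSemidef, trace_density, -⟩ := isGroundState n
    calc
      _ = ‖(density G o (B n) * (A.obs n - embed G o hn (A.obs N))).trace‖ := by
        rw [dist_eq_norm, mul_sub, Matrix.trace_sub, trace_density_mul_embed hG hdeg hc hB]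
      _ ≤ ‖Matrix.toEuclideanCLM (𝕜 := ℂ) (A.obs n - embed G o hn (A.obs N))‖ := by
        have := norm_trace_mul_le_of_posSemidef density_posSemidef
          (A.obs n - embed G o hn (A.obs N))
        rwa [trace_density, norm_one, one_mul] at this
      _ ≤ ε / 2 := hN n hn
      _ < ε := half_lt_self hε
  choose ω hω using exists_limit
  refine ⟨ω, ⟨B, fun n => ⟨posSemidef n, isGroundState n⟩, hω⟩, fun m A => ?_⟩
  refine tendsto_nhds_unique (hω _) (tendsto_const_nhds.congr' ?_)
  filter_upwards [Filter.eventually_ge_atTop m] with n hn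
  rw [QuasiLocalObs.ofLocal_obs hn, trace_density_mul_embed hG hdeg hc hB]

end GroundState

section Root

variable {V : Type*} [DecidableEq V] {G : SimpleGraph V} [G.LocallyFinite] {o : V} {d : ℕ}

theorem vbs_mul_bdryProd_mul_apply_self (hG : G.IsTree) (hdeg : G.IsRegularOfDegree d)
    (b : Fin 2 → ℝ) (s : Config G o d 0) :
    (vbs G o d 0 * bdryProd G o 0 b * (vbs G o d 0).conjTranspose) s s =
      ((b 0 ^ (s default : ℕ) * b 1 ^ (d - s default) / (d + 1) : ℝ) : ℂ) := by
  have card_boundary : Fintype.card (layer G o 1) = d := by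
    rw [Fintype.card_coe, card_layer_one, hdeg o]
  have choose_ne : (d.choose (s default) : ℝ) ≠ 0 :=
    Nat.cast_ne_zero.2 (Nat.choose_pos (Fin.is_le _)).ne'
  calc
    _ = ∑ τ : BdryConfig G o 0, (∏ y, (b (τ y) : ℂ)) *
        (vertexAmplitude d (downCount τ) (s default) : ℂ) ^ 2 := by
      rw [bdryProd, Matrix.mul_apply]
      simp only [Matrix.mul_diagonal, Matrix.conjTranspose_apply, vbs_zero hG hdeg, star_mul',
        Complex.star_def, Complex.conj_ofReal]
      refine Finset.sum_congr rfl fun τ _ => ?_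
      have sign_sq := singletSign_mul_star τ
      rw [Complex.star_def] at sign_sq
      linear_combination (∏ y, (b (τ y) : ℂ)) *
        (vertexAmplitude d (downCount τ) (s default) : ℂ) ^ 2 * sign_sq
    _ = _ := by
      rw [sum_prod_mul_downCount (fun i => (b i : ℂ))
        fun j => (vertexAmplitude d j (s default) : ℂ) ^ 2, card_boundary,
        Finset.sum_eq_single (s default : ℕ)]
      · rw [vertexAmplitude, if_pos rfl, ← Complex.ofReal_pow (weylNorm _ _)⁻¹, inv_pow,
          weylNorm_sq]
        norm_cast
        field_simp
        push_cast
        ring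
      · intro j _ hj
        simp [vertexAmplitude, hj.symm]
      · simp [Fin.is_le]

theorem trace_vbs_mul_bdryProd (hG : G.IsTree) (hdeg : G.IsRegularOfDegree d) (b : Fin 2 → ℝ) :
    (vbs G o d 0 * bdryProd G o 0 b * (vbs G o d 0).conjTranspose).trace =
      ((∑ j : Fin (d + 1), b 0 ^ (j : ℕ) * b 1 ^ (d - j) / (d + 1) : ℝ) : ℂ) := by
  rw [Matrix.trace, Complex.ofReal_sum]
  exact Fintype.sum_equiv (Equiv.funUnique _ _) _ _ fun s =>
    vbs_mul_bdryProd_mul_apply_self hG hdeg b s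

theorem trace_vbs_mul_bdryProd_ne_zero (hG : G.IsTree) (hdeg : G.IsRegularOfDegree d)
    {b : Fin 2 → ℝ} (hb : ∀ i, 0 < b i) :
    (vbs G o d 0 * bdryProd G o 0 b * (vbs G o d 0).conjTranspose).trace ≠ 0 := by
  rw [trace_vbs_mul_bdryProd hG hdeg, Complex.ofReal_ne_zero]
  refine (Finset.sum_pos (fun j _ => ?_) Finset.univ_nonempty).ne'
  have := hb 0
  have := hb 1
  positivity

theorem trace_vbs_mul_bdryProd_comp_rev (hG : G.IsTree) (hdeg : G.IsRegularOfDegree d)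
    (b : Fin 2 → ℝ) :
    (vbs G o d 0 * bdryProd G o 0 (b ∘ Fin.rev) * (vbs G o d 0).conjTranspose).trace =
      (vbs G o d 0 * bdryProd G o 0 b * (vbs G o d 0).conjTranspose).trace := by
  rw [trace_vbs_mul_bdryProd hG hdeg, trace_vbs_mul_bdryProd hG hdeg, Complex.ofReal_inj]
  refine Fintype.sum_equiv Fin.revPerm _ _ fun j => ?_
  have : (Fin.revPerm j : ℕ) = d - j := by simp [Fin.val_rev]
  rw [this, Nat.sub_sub_self (Fin.is_le j)]
  simp [mul_comm]

theorem trace_density_neelWeight_mul_single_ne (hG : G.IsTree) (hdeg : G.IsRegularOfDegree d)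
    (hd : d ≠ 0) {r : ℝ} (hr0 : 0 < r) (hr1 : r < 1) :
    (density (d := d) G o (bdryProd G o 0 (neelWeight r 0)) * Matrix.single 0 0 1).trace ≠
      (density (d := d) G o (bdryProd G o 0 (neelWeight r 1)) * Matrix.single 0 0 1).trace := by
  have trace_ne := trace_vbs_mul_bdryProd_ne_zero (o := o) hG hdeg (neelWeight_pos hr0 0)
  rw [Matrix.trace_mul_single, Matrix.trace_mul_single, density, density, Matrix.smul_apply,
    Matrix.smul_apply, vbs_mul_bdryProd_mul_apply_self hG hdeg,
    vbs_mul_bdryProd_mul_apply_self hG hdeg, neelWeight_succ r 0,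
    trace_vbs_mul_bdryProd_comp_rev hG hdeg, MulOpposite.op_one, one_smul, one_smul]
  intro h
  have weight_eq : 1 / ((d : ℝ) + 1) = r ^ d / (d + 1) := by
    simpa [neelWeight] using
      Complex.ofReal_injective (smul_right_injective ℂ (inv_ne_zero trace_ne) h)
  exact (pow_lt_one₀ hr0.le hr1 hd).ne ((div_left_inj' (by positivity)).1 weight_eq).symm

theorem exists_isInfiniteVolumeGroundState_neelWeight (hG : G.IsTree)
    (hdeg : G.IsRegularOfDegree d) {r c : ℝ} (hr : 0 < r) (hc : 0 < c)
    (h : ∀ k, transferWeight d (neelWeight r (k + 1)) = c • neelWeight r k) (k : ℕ) :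
    ∃ ω : QuasiLocalObs G o d → ℂ, IsInfiniteVolumeGroundState G o ω ∧
      ∀ (m : ℕ) (A : Obs G o d m), ω (QuasiLocalObs.ofLocal A) =
        (density G o (bdryProd G o m (neelWeight r (k + m))) * A).trace :=
  exists_isInfiniteVolumeGroundState hG hdeg
    (c := fun n => (c : ℂ) ^ (layer G o (n + 1)).card)
    (fun n => pow_ne_zero _ (Complex.ofReal_ne_zero.2 hc.ne'))
    (fun n => by rw [transferMap_bdryProd hG hdeg, ← bdryProd_smul, ← add_assoc, h])
    (fun n => posSemidef_bdryProd fun i => (neelWeight_pos hr _ i).le)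
    (trace_vbs_mul_bdryProd_ne_zero hG hdeg (neelWeight_pos hr _))

end Root

end AKLT

theorem mainTheorem6 {V : Type*} [DecidableEq V] (G : SimpleGraph V) [G.LocallyFinite] (o : V) (d : ℕ)
    (hd : 5 ≤ d) (hG : G.IsTree) (hdeg : G.IsRegularOfDegree d) :
    ∃ ω₁ ω₂ : AKLT.QuasiLocalObs G o d → ℂ,
      AKLT.IsInfiniteVolumeGroundState G o ω₁ ∧ AKLT.IsInfiniteVolumeGroundState G o ω₂ ∧
        ω₁ ≠ ω₂ := by
  open AKLT in
  obtain ⟨r, c, hr0, hr1, hc, hfix⟩ := exists_transferWeight_neelWeight_eq_smul hd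
  obtain ⟨ω₁, ground₁, apply₁⟩ :=
    exists_isInfiniteVolumeGroundState_neelWeight (o := o) hG hdeg hr0 hc hfix 0
  obtain ⟨ω₂, ground₂, apply₂⟩ :=
    exists_isInfiniteVolumeGroundState_neelWeight (o := o) hG hdeg hr0 hc hfix 1
  refine ⟨ω₁, ω₂, ground₁, ground₂, ?_⟩
  rintro rfl
  exact trace_density_neelWeight_mul_single_ne (o := o) hG hdeg (by omega) hr0 hr1
    ((apply₁ 0 _).symm.trans (apply₂ 0 _))
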